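/- Let $K$ be a number field with ring of integers $O$, and let $T$ be an order of $K$, i.e. a subring of $K$ that is finitely generated as a $\mathbb Z$-module and spans $K$ over $\mathbb Q$. For lattices $A,B\subset K$ put $[A:B]=[A:A\cap B]\,/\,[B:A\cap B]$. For a nonzero fractional ideal $I$ of $T$ define its discrepancy by $$\delta(I)=\frac{N_O(OI)}{N_T(I)}=\frac{[O:OI]}{[T:I]} .$$ For fractional ideals $I,J$ of $T$ let $(I:J)=\{a\in K: aJ\subset I\}$. Let $\mathfrak D_T=(T:T^\vee)$ be the different of $T$, where $T^\vee=\{x\in K:\operatorname{Tr}_{K/\mathbb Q}(xT)\subset\mathbb Z\}$, and let $\mathfrak f=(T:O)$ be the conductor of $T$. Recall that a Noetherian commutative ring is Gorenstein if each of its localizations at prime ideals has finite injective dimension as a module over itself. Then: 1. The following are equivalent: (a) $\delta(\mathfrak D_T)=1$; (b) for every nonzero ideal $J$ of $T$, $\delta(J)=1$ if and only if $T=(J:J)$; (c) $T$ is Gorenstein. 2. For every nonzero projective fractional ideal $P$ of $T$ and every nonzero fractional ideal $I$ of $T$, $\delta(PI)=\delta(I)$. 3. For every nonzero fractional ideal $I$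 of $T$, $1\le\delta(I)\le[O:T]\cdot[O:\mathfrak f]$. -/

import Mathlib

namespace OrderDiscrepancy

universe u

/-- A Gorenstein ring: a Noetherian commutative ring all of whose localizations at prime ideals
have finite injective dimension as modules over themselves. -/
def IsGorensteinRing (R : Type u) [CommRing R] : Prop :=
  IsNoetherianRing R ∧ ∀ (p : Ideal R) [p.IsPrime], ∃ n : ℕ,
    CategoryTheory.HasInjectiveDimensionLE
      (ModuleCat.of (Localization.AtPrime p) (Localization.AtPrime p)) n

variable {K : Type u} [Field K] [NumberField K]

/-- An order of the number field `K`: a subring that is finitely generated as an abelian group and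
spans `K` over `ℚ`. -/
structure IsOrder (T : Subring K) : Prop where
  finite : Module.Finite ℤ T
  span_eq_top : Submodule.span ℚ (T : Set K) = ⊤

/-- The generalized index `[A : B] = [A : A ∩ B] / [B : A ∩ B]` of two lattices in `K`. -/
noncomputable def latticeIndex (A B : AddSubgroup K) : ℚ :=
  ((A ⊓ B).relIndex A : ℚ) / ((A ⊓ B).relIndex B : ℚ)

variable (K) in
/-- The ring of integers of `K`, as a lattice in `K`. -/
def integers : AddSubgroup K :=
  (algebraMap (NumberField.RingOfIntegers K) K).range.toAddSubgroup

/-- The `𝓞 K`-module `𝓞 K · I` generated by `I` in `K`. -/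
def extend {T : Subring K} (I : Submodule T K) : Submodule (NumberField.RingOfIntegers K) K :=
  Submodule.span (NumberField.RingOfIntegers K) (I : Set K)

/-- The discrepancy `N_O(O I) / N_T(I)`, where `N_O(O I) = [O : O I]` and `N_T(I) = [T : I]`. -/
noncomputable def discrepancy {T : Subring K} (I : Submodule T K) : ℚ :=
  latticeIndex (integers K) (extend I).toAddSubgroup /
    latticeIndex T.toAddSubgroup I.toAddSubgroup

/-- The different `(T : T^∨)` of `T`, with `T^∨ = {x ∈ K : Tr(x T) ⊆ ℤ}`. -/
noncomputable def different (T : Subring K) : Submodule T K :=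
  1 / Submodule.traceDual ℤ ℚ (1 : Submodule T K)

/-- The conductor `(T : O) = {a : a O ⊆ T}` of `T` (any such `a` lies in `T`, so in `O` when `T` is
an order), as an ideal of `O = 𝓞 K`. -/
def conductor (T : Subring K) : Ideal (NumberField.RingOfIntegers K) where
  carrier := {a | ∀ b : NumberField.RingOfIntegers K, ((a * b : NumberField.RingOfIntegers K) : K) ∈ T}
  zero_mem' b := by simp [zero_mem]
  add_mem' ha hb c := by simpa only [add_mul, map_add] using T.add_mem (ha c) (hb c)
  smul_mem' c a ha b := by
    simpa only [smul_eq_mul, mul_left_comm, mul_assoc] using ha (c * b)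

end OrderDiscrepancy

/-! Multiplicativity of indices turns the discrepancy into δ(I) = [O:T] / [OI:I], so the lower bound
δ(I) ≥ 1 says [OI:I] ≤ [O:T], and the upper bound follows from [OI:I] ≥ 1.

The lower bound is a counting form of Gauss's lemma. Choose a polynomial f of degree d whose
coefficients generate I. Multiplication by f sends T^N into I^(N+d), and by Gauss's lemma over O a
factor whose product with f has coefficients in nOI has its own coefficients in nO. Hence [T:nO]^N ≤
[I:nOI]^(N+d), and letting N grow gives [T:nO] ≤ [I:nOI]. Since [O:T][T:nO] = [O:nO] = [OI:nOI] =
[OI:I][I:nOI], this is the claim (`index_maximalOrder_mul_le`).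

If δ(I) = 1, then f T^N fills I^(N+d) modulo nOI up to an index bounded independently of N, and
reduction modulo an ideal P gives [I:PI] ≤ [T:P] (`index_mul_self_le`). For P maximal, I/PI is at
most a line over T/P, so Nakayama makes I locally principal: discrepancy one implies invertible.
Conversely, multiplication by an invertible lattice preserves indices (`index_mul_mul_of_isUnit`),
which gives part 2 and δ = 1 for invertible lattices.

In part 1 each condition is equivalent to invertibility of W = T^∨. For (a) and (b) this is duality:
(IJ)^∨ = (J^∨:I), so (J:J) = T forces J J^∨ = W, while W itself has multiplier ring T. For (c), K/W
is the character module of T, hence injective; if W is invertible, then R → K → K/R is an injective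
resolution of each localization R. Conversely, if R has finite injective dimension, counting Ext
groups of finite modules gives |Ext¹(k,R)| ≤ |k| for the residue field k, so (T:p)/T is at most a
line; by duality so is W/pW, and W is invertible. -/

namespace OrderDiscrepancy

open Polynomial nonZeroDivisors

set_option linter.unusedSectionVars false

section

variable {K : Type*} [Field K] [NumberField K] {T : Subring K}

/-! ### Lattices, indices and a formula for the discrepancy. -/

section Basics

theorem IsOrder.exists_nat_mul_mem (hT : IsOrder T) (x : K) : ∃ n : ℕ, n ≠ 0 ∧ (n : K) * x ∈ T := by
  have hx : x ∈ Submodule.span ℚ (T : Set K) := hT.span_eq_top ▸ Submodule.mem_top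
  induction hx using Submodule.span_induction with
  | mem x hx => exact ⟨1, one_ne_zero, by simpa using hx⟩
  | zero => exact ⟨1, one_ne_zero, by simp⟩
  | add x y _ _ hx hy =>
    obtain ⟨n, hn, hnx⟩ := hx
    obtain ⟨m, hm, hmy⟩ := hy
    refine ⟨n * m, mul_ne_zero hn hm, ?_⟩
    have := T.add_mem (T.mul_mem (natCast_mem T m) hnx) (T.mul_mem (natCast_mem T n) hmy)
    convert this using 1
    push_cast
    ring
  | smul a x _ hx =>
    obtain ⟨n, hn, hnx⟩ := hx
    refine ⟨a.den * n, mul_ne_zero a.den_nz hn, ?_⟩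
    have := T.mul_mem (intCast_mem T a.num) hnx
    convert this using 1
    have h : (a.den : K) * (a : K) = a.num := by exact_mod_cast congrArg ((↑) : ℚ → K) a.den_mul_eq_num
    rw [Rat.smul_def]
    push_cast
    linear_combination (n : K) * x * h

theorem IsOrder.isIntegral (hT : IsOrder T) {x : K} (hx : x ∈ T) : IsIntegral ℤ x := by
  have := hT.finite
  exact (Algebra.IsIntegral.isIntegral (R := ℤ) (⟨x, hx⟩ : T)).map (T.subtype.toIntAlgHom)

theorem IsOrder.isNoetherianRing (hT : IsOrder T) : IsNoetherianRing T := by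
  have := hT.finite
  exact IsNoetherianRing.of_finite ℤ T

theorem IsOrder.isFractionRing (hT : IsOrder T) : IsFractionRing T K := by
  refine IsFractionRing.of_field T K fun z => ?_
  obtain ⟨n, hn, hz⟩ := hT.exists_nat_mul_mem z
  refine ⟨⟨_, hz⟩, (n : T), ?_⟩
  have : (n : K) ≠ 0 := by exact_mod_cast hn
  simp only [map_natCast]
  rw [eq_div_iff this, mul_comm]
  rfl

theorem mem_integers {x : K} : x ∈ integers K ↔ IsIntegral ℤ x := by
  constructor
  · rintro ⟨y, rfl⟩
    exact y.isIntegral_coe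
  · intro hx
    exact ⟨⟨x, hx⟩, rfl⟩

variable (T) in
/-- The ring of integers of `K`, as a `T`-submodule of `K`. -/
def maximalOrder : Submodule T K := Submodule.span T (integers K : Set K)

theorem IsOrder.mem_maximalOrder (hT : IsOrder T) {x : K} :
    x ∈ maximalOrder T ↔ IsIntegral ℤ x := by
  constructor
  · intro hx
    induction hx using Submodule.span_induction with
    | mem x hx => exact mem_integers.1 hx
    | zero => exact isIntegral_zero
    | add x y _ _ hx hy => exact hx.add hy
    | smul a x _ hx => exact (hT.isIntegral a.2).mul hx
  · intro hx
    exact Submodule.subset_span (mem_integers.2 hx)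

theorem IsOrder.toAddSubgroup_maximalOrder (hT : IsOrder T) :
    (maximalOrder T).toAddSubgroup = integers K := by
  ext x
  rw [Submodule.mem_toAddSubgroup, hT.mem_maximalOrder, mem_integers]

theorem mem_one_iff {x : K} : x ∈ (1 : Submodule T K) ↔ x ∈ T := by
  rw [Submodule.mem_one]
  exact ⟨fun ⟨y, hy⟩ => hy ▸ y.2, fun hx => ⟨⟨x, hx⟩, rfl⟩⟩

theorem one_mem_one : (1 : K) ∈ (1 : Submodule T K) := mem_one_iff.2 T.one_mem

theorem IsOrder.one_le_maximalOrder (hT : IsOrder T) : 1 ≤ maximalOrder T := by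
  intro x hx
  exact hT.mem_maximalOrder.2 (hT.isIntegral (mem_one_iff.1 hx))

theorem toAddSubgroup_one : (1 : Submodule T K).toAddSubgroup = T.toAddSubgroup := by
  ext x
  exact mem_one_iff

theorem fg_maximalOrder : (maximalOrder T).FG := by
  have h : (Submodule.span ℤ (integers K : Set K)).FG := by
    have : (LinearMap.range ((algebraMap (NumberField.RingOfIntegers K) K).toIntAlgHom.toLinearMap)).FG :=
      Module.Finite.iff_fg.1 (Module.Finite.range _)
    have h : Submodule.span ℤ (integers K : Set K) =
        LinearMap.range ((algebraMap (NumberField.RingOfIntegers K) K).toIntAlgHom.toLinearMap) := by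
      rw [← AddSubgroup.toIntSubmodule_closure, AddSubgroup.closure_eq]
      rfl
    rwa [h]
  obtain ⟨s, hs⟩ := h
  refine ⟨s, le_antisymm (Submodule.span_mono ?_) (Submodule.span_le.2 ?_)⟩
  · intro x hx
    have : x ∈ Submodule.span ℤ (s : Set K) := Submodule.subset_span hx
    rw [hs, ← AddSubgroup.toIntSubmodule_closure, AddSubgroup.closure_eq] at this
    exact this
  · intro x hx
    have : x ∈ Submodule.span ℤ (s : Set K) := hs ▸ Submodule.subset_span hx
    exact Submodule.span_le_restrictScalars ℤ T _ this

theorem maximalOrder_mul_self (hT : IsOrder T) :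
    maximalOrder T * maximalOrder T = maximalOrder T := by
  refine le_antisymm (Submodule.mul_le.2 fun x hx y hy => ?_) ?_
  · rw [hT.mem_maximalOrder] at *
    exact hx.mul hy
  · calc maximalOrder T = 1 * maximalOrder T := (one_mul _).symm
      _ ≤ _ := mul_le_mul_left hT.one_le_maximalOrder _

theorem toAddSubgroup_extend (hT : IsOrder T) (I : Submodule T K) :
    (extend I).toAddSubgroup = (maximalOrder T * I).toAddSubgroup := by
  ext x
  simp only [Submodule.mem_toAddSubgroup, extend]
  constructor
  · intro hx
    induction hx using Submodule.span_induction with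
    | mem x hx =>
      simpa using Submodule.mul_mem_mul (hT.one_le_maximalOrder (one_mem_one)) hx
    | zero => exact zero_mem _
    | add x y _ _ hx hy => exact add_mem hx hy
    | smul a x _ hx =>
      have := Submodule.mul_mem_mul (hT.mem_maximalOrder.2 a.isIntegral_coe) hx
      rw [← mul_assoc, maximalOrder_mul_self hT] at this
      exact this
  · intro hx
    refine Submodule.mul_induction_on hx (fun m hm n hn => ?_) fun x y hx hy => add_mem hx hy
    rw [hT.mem_maximalOrder] at hm
    exact Submodule.smul_mem _ (⟨m, hm⟩ : NumberField.RingOfIntegers K) (Submodule.subset_span hn)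

/-- The index `[A : A ∩ B]` of submodules of `K`. -/
noncomputable abbrev index (B A : Submodule T K) : ℕ := B.toAddSubgroup.relIndex A.toAddSubgroup

theorem exists_nat_mul_mem_submodule (hT : IsOrder T) {B : Submodule T K} (hB : B ≠ ⊥) (x : K) :
    ∃ n : ℕ, n ≠ 0 ∧ (n : K) * x ∈ B := by
  obtain ⟨b, hb, hb0⟩ := Submodule.exists_mem_ne_zero_of_ne_bot hB
  obtain ⟨n, hn, h⟩ := hT.exists_nat_mul_mem (x / b)
  refine ⟨n, hn, ?_⟩
  have := B.smul_mem ⟨_, h⟩ hb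
  rwa [Subring.smul_def, smul_eq_mul, mul_assoc, div_mul_cancel₀ _ hb0] at this

theorem exists_nat_forall_mul_mem (hT : IsOrder T) {A B : Submodule T K} (hA : A.FG) (hB : B ≠ ⊥) :
    ∃ n : ℕ, n ≠ 0 ∧ ∀ x ∈ A, (n : K) * x ∈ B := by
  classical
  obtain ⟨s, rfl⟩ := hA
  choose n hn h using exists_nat_mul_mem_submodule hT hB
  refine ⟨∏ x ∈ s, n x, Finset.prod_ne_zero_iff.2 fun x _ => hn x, fun x hx => ?_⟩
  induction hx using Submodule.span_induction with
  | mem x hx =>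
    rw [← Finset.prod_erase_mul s _ hx, Nat.cast_mul, mul_assoc]
    have := B.smul_mem ((∏ y ∈ s.erase x, n y : ℕ) : T) (h x)
    simpa [Subring.smul_def] using this
  | zero => simp
  | add x y _ _ hx hy => rw [mul_add]; exact add_mem hx hy
  | smul a x _ hx => rw [mul_smul_comm]; exact B.smul_mem a hx

theorem IsOrder.finite_int (hT : IsOrder T) {A : Submodule T K} (hA : A.FG) : Module.Finite ℤ A := by
  have := hT.finite
  have := Module.Finite.iff_fg.2 hA
  exact Module.Finite.trans T A

theorem index_ne_zero (hT : IsOrder T) {A B : Submodule T K} (hA : A.FG) (hB : B ≠ ⊥) :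
    index B A ≠ 0 := by
  obtain ⟨n, hn, h⟩ := exists_nat_forall_mul_mem hT hA hB
  rw [index, AddSubgroup.relIndex, AddSubgroup.index_ne_zero_iff_finite]
  have := hT.finite_int hA
  have : Module.Finite ℤ A.toAddSubgroup := this
  have : Module.Finite ℤ (A.toAddSubgroup ⧸ B.toAddSubgroup.addSubgroupOf A.toAddSubgroup) :=
    Module.Finite.of_surjective
      (QuotientAddGroup.mk' (B.toAddSubgroup.addSubgroupOf A.toAddSubgroup)).toIntLinearMap
      (QuotientAddGroup.mk'_surjective _)
  refine Module.finite_of_fg_torsion _ ?_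
  intro x
  obtain ⟨x, rfl⟩ := QuotientAddGroup.mk'_surjective _ x
  refine ⟨⟨n, by simpa using hn⟩, ?_⟩
  refine (map_zsmul (QuotientAddGroup.mk' _) (n : ℤ) x).symm.trans
    ((QuotientAddGroup.eq_zero_iff _).2 ?_)
  rw [AddSubgroup.mem_addSubgroupOf]
  simpa using h x x.2

theorem index_mul_index {A B C : Submodule T K} (h₁ : A ≤ B) (h₂ : B ≤ C) :
    index A B * index B C = index A C :=
  AddSubgroup.relIndex_mul_relIndex _ _ _ h₁ h₂

theorem index_eq_one {A B : Submodule T K} : index A B = 1 ↔ B ≤ A :=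
  AddSubgroup.relIndex_eq_one

theorem latticeIndex_of_le {A B : AddSubgroup K} (h : B ≤ A) :
    latticeIndex A B = B.relIndex A := by
  simp [latticeIndex, inf_eq_right.2 h]

/-- Any common sublattice may replace A ∩ B: its index in A ∩ B cancels. -/
theorem latticeIndex_eq_of_le {A B C : AddSubgroup K} (hA : C ≤ A) (hB : C ≤ B)
    (hC : C.relIndex A ≠ 0) :
    latticeIndex A B = C.relIndex A / C.relIndex B := by
  have hle : C ≤ A ⊓ B := le_inf hA hB
  have h₁ := AddSubgroup.relIndex_mul_relIndex _ _ _ hle inf_le_left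
  have h₂ := AddSubgroup.relIndex_mul_relIndex _ _ _ hle inf_le_right
  have h₀ : (C.relIndex (A ⊓ B) : ℚ) ≠ 0 := by
    intro h
    rw [Nat.cast_eq_zero] at h
    rw [h, zero_mul] at h₁
    exact hC h₁.symm
  rw [latticeIndex, ← h₁, ← h₂]
  push_cast
  rw [mul_div_mul_left _ _ h₀]

theorem maximalOrder_ne_bot (hT : IsOrder T) : maximalOrder T ≠ ⊥ := by
  intro h
  have : (1 : K) ∈ maximalOrder T := hT.mem_maximalOrder.2 isIntegral_one
  rw [h] at this
  simp at this

theorem le_maximalOrder_mul (hT : IsOrder T) (I : Submodule T K) : I ≤ maximalOrder T * I :=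
  calc I = 1 * I := (one_mul _).symm
    _ ≤ _ := mul_le_mul_left hT.one_le_maximalOrder _

theorem one_ne_bot : (1 : Submodule T K) ≠ ⊥ := by
  intro h
  have : (1 : K) ∈ (1 : Submodule T K) := one_mem_one
  rw [h] at this
  simp at this

theorem fg_one : (1 : Submodule T K).FG := by
  rw [Submodule.one_eq_span]
  exact Submodule.fg_span_singleton 1

theorem ne_bot_of_le {A B : Submodule T K} (h : A ≤ B) (hA : A ≠ ⊥) : B ≠ ⊥ :=
  fun hB => hA (le_bot_iff.1 (hB ▸ h))

/-- The submodule `n A` of `A`, for a natural number `n`. -/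
def natMul (n : ℕ) (A : Submodule T K) : Submodule T K :=
  A.map (LinearMap.mulLeft T (n : K))

theorem mem_natMul {n : ℕ} {A : Submodule T K} {x : K} :
    x ∈ natMul n A ↔ ∃ y ∈ A, (n : K) * y = x := Iff.rfl

theorem natMul_le (n : ℕ) (A : Submodule T K) : natMul n A ≤ A := by
  rintro _ ⟨y, hy, rfl⟩
  simpa [Subring.smul_def] using A.smul_mem (n : T) hy

theorem natMul_ne_bot {n : ℕ} (hn : n ≠ 0) {A : Submodule T K} (hA : A ≠ ⊥) :
    natMul n A ≠ ⊥ := by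
  obtain ⟨b, hb, hb0⟩ := Submodule.exists_mem_ne_zero_of_ne_bot hA
  exact Submodule.ne_bot_iff _ |>.2 ⟨n * b, ⟨b, hb, rfl⟩, mul_ne_zero (by exact_mod_cast hn) hb0⟩

theorem natMul_mono (n : ℕ) {A B : Submodule T K} (h : A ≤ B) : natMul n A ≤ natMul n B :=
  Submodule.map_mono h

theorem natMul_natMul (n m : ℕ) (A : Submodule T K) :
    natMul n (natMul m A) = natMul m (natMul n A) := by
  ext x
  simp only [mem_natMul, exists_exists_and_eq_and]
  simp only [mul_left_comm]

theorem toAddSubgroup_natMul (n : ℕ) (A : Submodule T K) :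
    (natMul n A).toAddSubgroup = A.toAddSubgroup.map (AddMonoidHom.mulLeft (n : K)) := rfl

theorem index_natMul_natMul {n : ℕ} (hn : n ≠ 0) (A B : Submodule T K) :
    index (natMul n A) (natMul n B) = index A B := by
  have hn' : (n : K) ≠ 0 := by exact_mod_cast hn
  rw [index, toAddSubgroup_natMul, toAddSubgroup_natMul]
  exact AddSubgroup.relIndex_map_map_of_injective _ _ (mul_right_injective₀ hn')

/-- The chains nA ≤ A ≤ B and nA ≤ nB ≤ B both compute [B:nA], and [nB:nA] = [B:A]. -/
theorem index_natMul_self_of_le (hT : IsOrder T) {n : ℕ} (hn : n ≠ 0) {A B : Submodule T K}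
    (hAB : A ≤ B) (hA : A ≠ ⊥) (hB : B.FG) :
    index (natMul n A) A = index (natMul n B) B := by
  have h₁ := index_mul_index (natMul_le n A) hAB
  have h₂ := index_mul_index (natMul_mono n hAB) (natMul_le n B)
  rw [index_natMul_natMul hn, ← h₁, mul_comm] at h₂
  exact (Nat.eq_of_mul_eq_mul_right (Nat.pos_of_ne_zero (index_ne_zero hT hB hA)) h₂).symm

/-- The index of `n A` in a lattice `A` of `K` only depends on `n`. -/
theorem index_natMul_self (hT : IsOrder T) {n : ℕ} (hn : n ≠ 0) {A B : Submodule T K}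
    (hA : A ≠ ⊥) (hB : B ≠ ⊥) (hA' : A.FG) (hB' : B.FG) :
    index (natMul n A) A = index (natMul n B) B := by
  -- Scaling by m moves A inside B without changing the index of nA in A.
  obtain ⟨m, hm, h⟩ := exists_nat_forall_mul_mem hT hA' hB
  have h₁ : index (natMul n (natMul m A)) (natMul m A) = index (natMul n A) A := by
    rw [natMul_natMul, index_natMul_natMul hm]
  rw [← h₁]
  exact index_natMul_self_of_le hT hn (by rintro _ ⟨y, hy, rfl⟩; exact h y hy)
    (natMul_ne_bot hm hA) hB'

/-- All four indices are measured from a common sublattice nI ≤ T; what survives the cancellation is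
the ratio of two honest indices, the form used from here on. -/
theorem discrepancy_eq (hT : IsOrder T) {I : Submodule T K} (hI : I.FG) (hI0 : I ≠ ⊥) :
    discrepancy I = (index 1 (maximalOrder T) : ℚ) / index I (maximalOrder T * I) := by
  obtain ⟨n, hn, h⟩ := exists_nat_forall_mul_mem hT hI one_ne_bot
  have hC : natMul n I ≤ 1 := by rintro _ ⟨y, hy, rfl⟩; exact h y hy
  have hO := hT.one_le_maximalOrder
  have hII := le_maximalOrder_mul hT I
  have hC0 := natMul_ne_bot hn hI0
  have hOfg : (maximalOrder T).FG := fg_maximalOrder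
  have hOI : (maximalOrder T * I).FG := hOfg.mul hI
  have e₁ : latticeIndex (integers K) (extend I).toAddSubgroup =
      (index (natMul n I) (maximalOrder T) : ℚ) / index (natMul n I) (maximalOrder T * I) := by
    rw [toAddSubgroup_extend hT, ← hT.toAddSubgroup_maximalOrder]
    exact latticeIndex_eq_of_le (hC.trans hO) ((natMul_le n I).trans hII)
      (index_ne_zero hT hOfg hC0)
  have e₂ : latticeIndex T.toAddSubgroup I.toAddSubgroup =
      (index (natMul n I) 1 : ℚ) / index (natMul n I) I := by
    rw [← toAddSubgroup_one]
    exact latticeIndex_eq_of_le hC (natMul_le n I) (index_ne_zero hT fg_one hC0)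
  rw [discrepancy, e₁, e₂, ← index_mul_index hC hO, ← index_mul_index (natMul_le n I) hII]
  have h₁ : (index (natMul n I) 1 : ℚ) ≠ 0 := by exact_mod_cast index_ne_zero hT fg_one hC0
  have h₂ : (index (natMul n I) I : ℚ) ≠ 0 := by exact_mod_cast index_ne_zero hT hI hC0
  have h₃ : (index I (maximalOrder T * I) : ℚ) ≠ 0 := by
    exact_mod_cast index_ne_zero hT hOI hI0
  push_cast
  field_simp

end Basics

end

section

variable {K : Type*} [Field K] [NumberField K] {T : Subring K}

/-! ### Gauss's lemma through non-archimedean Gauss norms. -/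

section Gauss

open IsDedekindDomain

theorem isIntegral_of_forall_adicAbv_le_one {b : NNReal} (hb : 1 < b) {x : K}
    (h : ∀ v : HeightOneSpectrum (NumberField.RingOfIntegers K), v.adicAbv hb x ≤ 1) :
    IsIntegral ℤ x := by
  obtain ⟨y, rfl⟩ := HeightOneSpectrum.mem_integers_of_valuation_le_one K x fun v => by
    have := h v
    simpa [HeightOneSpectrum.adicAbv, HeightOneSpectrum.adicAbvDef,
      WithZeroMulInt.toNNReal_le_one_iff hb] using this
  exact y.isIntegral_coe

/-- Gauss's lemma over the ring of integers of a number field. -/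
theorem isIntegral_coeff_of_coeff_mul_mem (hT : IsOrder T) {f g : K[X]} (hf : f ≠ 0)
    (h : ∀ j, (f * g).coeff j ∈ maximalOrder T * Submodule.span T (Set.range f.coeff)) (j : ℕ) :
    IsIntegral ℤ (g.coeff j) := by
  have hb : (1 : NNReal) < 2 := one_lt_two
  -- At a finite place v the Gauss norm of radius 1 is multiplicative. The coefficients of f * g lie
  -- in O times the content of f, so they are bounded by the norm of f; cancelling that norm bounds
  -- g by 1.
  refine isIntegral_of_forall_adicAbv_le_one hb fun v => ?_
  have hna := v.isNonarchimedean_adicAbv hb (K := K)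
  have hint : ∀ x : K, IsIntegral ℤ x → v.adicAbv hb x ≤ 1 := fun x hx =>
    v.adicAbv_coe_le_one hb (⟨x, hx⟩ : NumberField.RingOfIntegers K)
  set w := v.adicAbv hb (K := K)
  have hnonneg : 0 ≤ f.gaussNorm w 1 := f.gaussNorm_nonneg w zero_le_one
  have hadd : ∀ x y : K, w x ≤ f.gaussNorm w 1 → w y ≤ f.gaussNorm w 1 →
      w (x + y) ≤ f.gaussNorm w 1 := fun x y hx hy => (hna x y).trans (max_le hx hy)
  have hsmul : ∀ x y : K, IsIntegral ℤ x → w y ≤ f.gaussNorm w 1 → w (x * y) ≤ f.gaussNorm w 1 := by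
    intro x y hx hy
    rw [map_mul]
    exact (mul_le_of_le_one_left (w.nonneg y) (hint x hx)).trans hy
  have hspan : ∀ x ∈ Submodule.span T (Set.range f.coeff), w x ≤ f.gaussNorm w 1 := by
    intro x hx
    induction hx using Submodule.span_induction with
    | mem x hx =>
      obtain ⟨i, rfl⟩ := hx
      simpa using f.le_gaussNorm w zero_le_one i
    | zero => simpa using hnonneg
    | add x y _ _ hx hy => exact hadd x y hx hy
    | smul a x _ hx => exact hsmul a x (hT.isIntegral a.2) hx
  have hmul : ∀ x ∈ maximalOrder T * Submodule.span T (Set.range f.coeff),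
      w x ≤ f.gaussNorm w 1 := by
    intro x hx
    refine Submodule.mul_induction_on hx (fun m hm n hn => ?_) hadd
    exact hsmul m n (hT.mem_maximalOrder.1 hm) (hspan n hn)
  have hle : (f * g).gaussNorm w 1 ≤ f.gaussNorm w 1 := by
    obtain ⟨i, hi⟩ := (f * g).exists_eq_gaussNorm w 1
    rw [hi, one_pow, mul_one]
    exact hmul _ (h i)
  rw [gaussNorm_mul hna one_pos] at hle
  have hpos : 0 < f.gaussNorm w 1 := lt_of_le_of_ne hnonneg fun h0 => hf
    ((gaussNorm_eq_zero_iff w f (fun _ hx => (AbsoluteValue.eq_zero w).1 hx) one_pos).1 h0.symm)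
  have := (g.le_gaussNorm w zero_le_one j)
  rw [one_pow, mul_one] at this
  exact this.trans (le_of_mul_le_mul_left (by simpa using hle) hpos)

end Gauss

/-! ### Counting coefficient tuples of polynomial multiples. -/

section Counting

/-- The constant c disappears on taking N-th roots; it will absorb the surplus deg f coordinates of
the target of multiplication by f. -/
theorem le_of_forall_pow_le_mul_pow {a b c : ℕ} (h : ∀ N, a ^ N ≤ c * b ^ N) : a ≤ b := by
  by_contra! hab
  rcases Nat.eq_zero_or_pos b with rfl | hb
  · have := h 1
    simp at this
    omega
  have hb' : (0 : ℝ) < b := by exact_mod_cast hb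
  have h1 : 1 < (a : ℝ) / b := by rw [one_lt_div hb']; exact_mod_cast hab
  obtain ⟨N, hN⟩ := pow_unbounded_of_one_lt (c : ℝ) h1
  rw [div_pow, lt_div_iff₀ (by positivity)] at hN
  exact absurd (h N) (not_le.2 (by exact_mod_cast hN))

/-- The group of `N`-tuples of elements of `A`. -/
abbrev tuples (N : ℕ) (A : Submodule T K) : AddSubgroup (Fin N → K) :=
  AddSubgroup.pi Set.univ fun _ => A.toAddSubgroup

theorem mem_tuples {N : ℕ} {A : Submodule T K} {x : Fin N → K} :
    x ∈ tuples N A ↔ ∀ i, x i ∈ A := by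
  simp [tuples, AddSubgroup.mem_pi]

theorem relIndex_tuples (N : ℕ) (A B : Submodule T K) :
    (tuples N B).relIndex (tuples N A) = index B A ^ N := by
  let ι : (Fin N → A) →+ (Fin N → K) :=
    { toFun := fun x i => x i
      map_zero' := rfl
      map_add' := fun _ _ => rfl }
  have h₁ : ι.range = tuples N A := by
    ext x
    rw [mem_tuples]
    constructor
    · rintro ⟨y, rfl⟩ i
      exact (y i).2
    · intro hx
      exact ⟨fun i => ⟨x i, hx i⟩, rfl⟩
  have h₂ : (tuples N B).comap ι = AddSubgroup.pi Set.univ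
      fun _ => B.toAddSubgroup.addSubgroupOf A.toAddSubgroup := by
    ext x
    rw [AddSubgroup.mem_comap, mem_tuples, AddSubgroup.mem_pi]
    simp only [Set.mem_univ, forall_const]
    rfl
  rw [← h₁, ← AddSubgroup.index_comap, h₂, AddSubgroup.index_pi]
  simp [index, AddSubgroup.relIndex]

open Classical in
/-- Multiplication by a polynomial, on tuples of coefficients. -/
noncomputable def mulTuple (f : K[X]) (N M : ℕ) : (Fin N → K) →+ (Fin M → K) where
  toFun g j := (f * ofFn N g).coeff j
  map_zero' := by ext; simp
  map_add' x y := by ext; simp [mul_add]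

/-- Realizes I as the content of a polynomial, so that Gauss's lemma applies to it. -/
theorem exists_span_range_coeff {I : Submodule T K} (hI : I.FG) :
    ∃ f : K[X], Submodule.span T (Set.range f.coeff) = I := by
  classical
  obtain ⟨n, s, rfl⟩ := Submodule.fg_iff_exists_fin_generating_family.1 hI
  refine ⟨ofFn n s, le_antisymm (Submodule.span_le.2 ?_) (Submodule.span_mono ?_)⟩
  · rintro _ ⟨j, rfl⟩
    by_cases hj : j < n
    · rw [ofFn_coeff_eq_val_of_lt s hj]
      exact Submodule.subset_span ⟨_, rfl⟩
    · rw [ofFn_coeff_eq_zero_of_ge s (not_lt.1 hj)]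
      exact zero_mem _
  · rintro _ ⟨j, rfl⟩
    exact ⟨j, by rw [ofFn_coeff_eq_val_of_lt s j.2]⟩

theorem mulTuple_mem {f : K[X]} {N M : ℕ} {A : Submodule T K} {g : Fin N → K}
    (hg : g ∈ tuples N A) :
    mulTuple f N M g ∈ tuples M (A * Submodule.span T (Set.range f.coeff)) := by
  classical
  rw [mem_tuples] at *
  intro j
  change (f * ofFn N g).coeff j ∈ _
  rw [mul_comm f, coeff_mul]
  refine Submodule.sum_mem _ fun p _ => Submodule.mul_mem_mul ?_ (Submodule.subset_span ⟨_, rfl⟩)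
  by_cases hj : p.1 < N
  · rw [ofFn_coeff_eq_val_of_lt g hj]
    exact hg _
  · rw [ofFn_coeff_eq_zero_of_ge g (not_lt.1 hj)]
    exact zero_mem _

/-- Gauss's lemma for f and g / n. The N + deg f coordinates hold every coefficient of the product,
so nothing is lost by truncation. -/
theorem mem_tuples_of_mulTuple_mem (hT : IsOrder T) {f : K[X]} (hf : f ≠ 0) {N n : ℕ} (hn : n ≠ 0)
    {g : Fin N → K} (h : mulTuple f N (N + f.natDegree) g ∈ tuples (N + f.natDegree)
      (natMul n (maximalOrder T * Submodule.span T (Set.range f.coeff)))) :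
    g ∈ tuples N (natMul n (maximalOrder T)) := by
  classical
  have hn' : (n : K) ≠ 0 := by exact_mod_cast hn
  rw [mem_tuples] at *
  have key : ∀ j, (f * ofFn N (fun i => g i / n)).coeff j ∈
      maximalOrder T * Submodule.span T (Set.range f.coeff) := by
    intro j
    have e : ofFn N g = C (n : K) * ofFn N (fun i => g i / n) := by
      rw [← smul_eq_C_mul, ← map_smul]
      congr 1
      ext i
      simp [mul_div_cancel₀ _ hn']
    by_cases hj : j < N + f.natDegree
    · obtain ⟨y, hy, hy'⟩ := mem_natMul.1 (h ⟨j, hj⟩)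
      change _ = (f * ofFn N g).coeff j at hy'
      rw [e, mul_left_comm, coeff_C_mul] at hy'
      rwa [← mul_left_cancel₀ hn' hy']
    -- The bound `natDegree < N` on the second factor fails for N = 0, where that factor is zero.
    · rcases N with _ | N
      · rw [show ofFn 0 (fun i => g i / (n : K)) = 0 from ofFn_zero' _, mul_zero, coeff_zero]
        exact zero_mem _
      · rw [coeff_eq_zero_of_natDegree_lt]
        · exact zero_mem _
        · have h₁ := ofFn_natDegree_lt (n := N + 1) (by omega) (fun i => g i / (n : K))
          have h₂ := natDegree_mul_le (p := f) (q := ofFn (N + 1) (fun i => g i / (n : K)))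
          omega
  intro i
  have := isIntegral_coeff_of_coeff_mul_mem hT hf key i
  rw [ofFn_coeff_eq_val_of_lt _ i.2] at this
  exact mem_natMul.2 ⟨_, hT.mem_maximalOrder.2 this, mul_div_cancel₀ _ hn'⟩

theorem map_mulTuple_le (f : K[X]) (N M : ℕ) :
    (tuples N (1 : Submodule T K)).map (mulTuple f N M) ≤
      tuples M (Submodule.span T (Set.range f.coeff)) := by
  rintro _ ⟨g, hg, rfl⟩
  simpa using mulTuple_mem hg

/-- By Gauss's lemma the preimage in T^N of the tuples in nOI lies in (nO)^N, so its index in T^N is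
at least [T:nO]^N. -/
theorem index_pow_le (hT : IsOrder T) {f : K[X]} (hf : f ≠ 0) {n : ℕ} (hn : n ≠ 0) (N : ℕ)
    (hfin : index (natMul n (maximalOrder T * Submodule.span T (Set.range f.coeff)))
      (Submodule.span T (Set.range f.coeff)) ≠ 0) :
    index (natMul n (maximalOrder T)) 1 ^ N ≤
      (tuples (N + f.natDegree)
        (natMul n (maximalOrder T * Submodule.span T (Set.range f.coeff)))).relIndex
        ((tuples N (1 : Submodule T K)).map (mulTuple f N (N + f.natDegree))) := by
  set Z := tuples (N + f.natDegree)
    (natMul n (maximalOrder T * Submodule.span T (Set.range f.coeff)))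
  -- `relIndex` is 0 for infinite index, so monotonicity needs finiteness first.
  have h₀ : Z.relIndex ((tuples N (1 : Submodule T K)).map (mulTuple f N (N + f.natDegree))) ≠ 0 := by
    refine fun h => ?_
    have := AddSubgroup.relIndex_eq_zero_of_le_right (map_mulTuple_le f N _) h
    rw [relIndex_tuples] at this
    exact pow_ne_zero _ hfin this
  rw [← AddSubgroup.relIndex_comap] at h₀ ⊢
  rw [← relIndex_tuples]
  rw [← AddSubgroup.inf_relIndex_right] at h₀ ⊢
  rw [← AddSubgroup.inf_relIndex_right (H := AddSubgroup.comap _ _)]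
  rw [AddSubgroup.inf_relIndex_right] at h₀
  refine AddSubgroup.relIndex_le_of_le_left (le_inf (fun g hg => ?_) inf_le_right) ?_
  · exact mem_tuples_of_mulTuple_mem hT hf hn hg.1
  · rwa [AddSubgroup.inf_relIndex_right]

theorem natMul_mul (n : ℕ) (A B : Submodule T K) : natMul n (A * B) = natMul n A * B := by
  refine le_antisymm ?_ (Submodule.mul_le.2 ?_)
  · rintro _ ⟨x, hx, rfl⟩
    refine Submodule.mul_induction_on hx (fun a ha b hb => ?_) fun x y hx hy => ?_
    · rw [LinearMap.mulLeft_apply, ← mul_assoc]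
      exact Submodule.mul_mem_mul ⟨a, ha, rfl⟩ hb
    · rw [map_add]
      exact add_mem hx hy
  · rintro _ ⟨x, hx, rfl⟩ b hb
    exact ⟨x * b, Submodule.mul_mem_mul hx hb, by simp [mul_assoc]⟩

/-- The two sides are [OI:nOI] and [O:nO], which agree by `index_natMul_self`. -/
theorem index_natMul_eq_index_natMul (hT : IsOrder T) {n : ℕ} (hn : n ≠ 0)
    (hn1 : natMul n (maximalOrder T) ≤ 1) {I : Submodule T K} (hI : I.FG) (hI0 : I ≠ ⊥) :
    index (natMul n (maximalOrder T * I)) I * index I (maximalOrder T * I) =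
      index (natMul n (maximalOrder T)) 1 * index 1 (maximalOrder T) := by
  have hle : natMul n (maximalOrder T * I) ≤ I := by
    rw [natMul_mul]
    simpa using mul_le_mul_left hn1 I
  rw [index_mul_index hle (le_maximalOrder_mul hT I), index_mul_index hn1 hT.one_le_maximalOrder]
  exact index_natMul_self hT hn (ne_bot_of_le (le_maximalOrder_mul hT I) hI0)
    (maximalOrder_ne_bot hT) (fg_maximalOrder.mul hI) fg_maximalOrder

theorem index_natMul_one_le (hT : IsOrder T) {n : ℕ} (hn : n ≠ 0)
    {I : Submodule T K} (hI : I.FG) (hI0 : I ≠ ⊥) :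
    index (natMul n (maximalOrder T)) 1 ≤ index (natMul n (maximalOrder T * I)) I := by
  obtain ⟨f, rfl⟩ := exists_span_range_coeff hI
  have hf : f ≠ 0 := by
    rintro rfl
    refine hI0 (Submodule.span_eq_bot.2 ?_)
    rintro _ ⟨j, rfl⟩
    simp
  have hfin : index (natMul n (maximalOrder T * Submodule.span T (Set.range f.coeff)))
      (Submodule.span T (Set.range f.coeff)) ≠ 0 :=
    index_ne_zero hT hI (natMul_ne_bot hn (ne_bot_of_le (le_maximalOrder_mul hT _) hI0))
  refine le_of_forall_pow_le_mul_pow (c := index (natMul n (maximalOrder T * Submodule.span T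
    (Set.range f.coeff))) (Submodule.span T (Set.range f.coeff)) ^ f.natDegree) fun N => ?_
  refine (index_pow_le hT hf hn N hfin).trans ?_
  rw [← pow_add, add_comm, ← relIndex_tuples]
  refine AddSubgroup.relIndex_le_of_le_right (map_mulTuple_le f N _) ?_
  rw [relIndex_tuples]
  exact pow_ne_zero _ hfin

theorem exists_natMul_maximalOrder_le (hT : IsOrder T) {A : Submodule T K} (hA : A ≠ ⊥) :
    ∃ n : ℕ, n ≠ 0 ∧ natMul n (maximalOrder T) ≤ A := by
  obtain ⟨n, hn, h⟩ := exists_nat_forall_mul_mem hT fg_maximalOrder hA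
  refine ⟨n, hn, ?_⟩
  rintro _ ⟨x, hx, rfl⟩
  exact h x hx

/-- In the identity [I:nOI][OI:I] = [T:nO][O:T] the first factor on the left is at least the first
on the right, so the second factors compare the other way. -/
theorem index_maximalOrder_mul_le (hT : IsOrder T) {I : Submodule T K} (hI : I.FG) (hI0 : I ≠ ⊥) :
    index I (maximalOrder T * I) ≤ index 1 (maximalOrder T) := by
  obtain ⟨n, hn, hn1⟩ := exists_natMul_maximalOrder_le hT one_ne_bot
  have h₁ := index_natMul_eq_index_natMul hT hn hn1 hI hI0
  have h₂ := index_natMul_one_le hT hn hI hI0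
  have h₃ := index_ne_zero hT fg_one (natMul_ne_bot hn (maximalOrder_ne_bot hT))
  by_contra! h
  have := Nat.mul_lt_mul_of_le_of_lt h₂ h (lt_of_lt_of_le (Nat.pos_of_ne_zero h₃) h₂)
  omega

/-- If the discrepancy of `I` is `1`, then `I / P I` is not larger than `T / P`. -/
theorem index_mul_self_le (hT : IsOrder T) {I : Submodule T K} (hI : I.FG) (hI0 : I ≠ ⊥)
    (h : index I (maximalOrder T * I) = index 1 (maximalOrder T)) {P : Submodule T K}
    (hP : P ≠ ⊥) (hP1 : P ≤ 1) : index (P * I) I ≤ index P 1 := by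
  obtain ⟨n, hn, hnP⟩ := exists_natMul_maximalOrder_le hT hP
  have h₁ := index_natMul_eq_index_natMul hT hn (hnP.trans hP1) hI hI0
  rw [h] at h₁
  replace h₁ := Nat.eq_of_mul_eq_mul_right
    (Nat.pos_of_ne_zero (index_ne_zero hT fg_maximalOrder one_ne_bot)) h₁
  obtain ⟨f, rfl⟩ := exists_span_range_coeff hI
  have hf : f ≠ 0 := by
    rintro rfl
    refine hI0 (Submodule.span_eq_bot.2 ?_)
    rintro _ ⟨j, rfl⟩
    simp
  set I := Submodule.span T (Set.range f.coeff) with hIdef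
  have hfin : index (natMul n (maximalOrder T * I)) I ≠ 0 :=
    index_ne_zero hT hI (natMul_ne_bot hn (ne_bot_of_le (le_maximalOrder_mul hT _) hI0))
  have hPI : P * I ≤ I := by simpa using mul_le_mul_left hP1 I
  have hZV : natMul n (maximalOrder T * I) ≤ P * I := by
    rw [natMul_mul]
    exact mul_le_mul_left hnP I
  have hPI0 : index (P * I) I ≠ 0 := fun h0 =>
    hfin (AddSubgroup.relIndex_eq_zero_of_le_left hZV h0)
  set i := index (natMul n (maximalOrder T * I)) I
  refine le_of_forall_pow_le_mul_pow (c := i ^ f.natDegree) fun N => ?_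
  set M := N + f.natDegree
  set U := (tuples N (1 : Submodule T K)).map (mulTuple f N M)
  have hU : U ≤ tuples M I := map_mulTuple_le f N M
  set Z := tuples M (natMul n (maximalOrder T * I))
  have hZ : Z ≤ tuples M I := fun x hx => by
    rw [mem_tuples] at *
    exact fun j => hPI (hZV (hx j))
  have hV : tuples M (P * I) ≤ tuples M I := fun x hx => by
    rw [mem_tuples] at *
    exact fun j => hPI (hx j)
  have hZV' : Z ≤ tuples M (P * I) := fun x hx => by
    rw [mem_tuples] at *
    exact fun j => hZV (hx j)
  have hZU : i ^ N ≤ Z.relIndex U := by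
    rw [h₁]
    exact index_pow_le hT hf hn N hfin
  -- Z has index i^(N + deg f) in I^M, and U already accounts for at least i^N of it; the remaining
  -- index is bounded independently of N.
  have hc : (U ⊔ Z).relIndex (tuples M I) ≤ i ^ f.natDegree := by
    have e := AddSubgroup.relIndex_mul_relIndex Z (U ⊔ Z) (tuples M I) le_sup_right (sup_le hU hZ)
    rw [AddSubgroup.relIndex_sup_right, relIndex_tuples, pow_add] at e
    have := Nat.mul_le_mul_right ((U ⊔ Z).relIndex (tuples M I)) hZU
    rw [e] at this
    exact Nat.le_of_mul_le_mul_left this (Nat.pos_of_ne_zero (pow_ne_zero _ hfin))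
  -- Multiplication by f sends P^N into (PI)^M, so this quotient of U is a quotient of (T/P)^N.
  have hk : (tuples M (P * I)).relIndex U ≤ index P 1 ^ N := by
    rw [← AddSubgroup.relIndex_comap, ← relIndex_tuples]
    refine AddSubgroup.relIndex_le_of_le_left (fun g hg => mulTuple_mem hg) ?_
    rw [relIndex_tuples]
    exact pow_ne_zero _ (index_ne_zero hT fg_one hP)
  have e := AddSubgroup.relIndex_mul_relIndex (tuples M (P * I)) (U ⊔ tuples M (P * I))
    (tuples M I) le_sup_right (sup_le hU hV)
  rw [AddSubgroup.relIndex_sup_right, relIndex_tuples] at e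
  have hc' : (U ⊔ tuples M (P * I)).relIndex (tuples M I) ≤ (U ⊔ Z).relIndex (tuples M I) := by
    refine AddSubgroup.relIndex_le_of_le_left (sup_le_sup_left hZV' U) fun h0 => ?_
    have := AddSubgroup.relIndex_eq_zero_of_le_left (H := Z) le_sup_right h0
    rw [relIndex_tuples] at this
    exact pow_ne_zero _ hfin this
  calc index (P * I) I ^ N ≤ index (P * I) I ^ M :=
        Nat.pow_le_pow_right (Nat.pos_of_ne_zero hPI0) (Nat.le_add_right _ _)
    _ ≤ index P 1 ^ N * i ^ f.natDegree := by
        rw [← e]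
        exact Nat.mul_le_mul hk (hc'.trans hc)
    _ = _ := mul_comm _ _

end Counting

end

section

variable {K : Type*} [Field K] [NumberField K] {T : Subring K}

/-! ### Invertible lattices: local criterion, indices, projectivity. -/

section Invertible

open IsLocalization Submodule

theorem smul_eq_coeSubmodule_mul (p : Ideal T) (I : Submodule T K) :
    p • I = coeSubmodule K p * I := by
  refine le_antisymm (smul_le.2 fun r hr n hn => ?_) (mul_le.2 ?_)
  · rw [Algebra.smul_def]
    exact mul_mem_mul ((mem_coeSubmodule K p).2 ⟨r, hr, rfl⟩) hn
  · rintro x hx y hy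
    obtain ⟨r, hr, rfl⟩ := (mem_coeSubmodule K p).1 hx
    rw [← Algebra.smul_def]
    exact smul_mem_smul hr hy

theorem coeSubmodule_le_one (p : Ideal T) : coeSubmodule K p ≤ 1 := by
  rw [← coeSubmodule_top (R := T) K]
  exact coeSubmodule_mono K le_top

theorem mem_coeSubmodule_iff {p : Ideal T} {t : T} : (t : K) ∈ coeSubmodule K p ↔ t ∈ p := by
  rw [mem_coeSubmodule]
  constructor
  · rintro ⟨s, hs, h⟩
    rwa [Subtype.ext (a1 := s) (a2 := t) h] at hs
  · exact fun h => ⟨t, h, rfl⟩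

theorem coeSubmodule_ne_bot {p : Ideal T} (hp : p ≠ ⊥) : coeSubmodule K p ≠ ⊥ := by
  obtain ⟨x, hx, hx0⟩ := Submodule.exists_mem_ne_zero_of_ne_bot hp
  refine (Submodule.ne_bot_iff _).2 ⟨x, mem_coeSubmodule_iff.2 hx, ?_⟩
  exact fun h => hx0 (Subtype.ext h)

theorem isUnit_iff_mul_one_div {I : Submodule T K} : IsUnit I ↔ I * (1 / I) = 1 := by
  refine ⟨fun h => ?_, fun h => IsUnit.of_mul_eq_one _ h⟩
  obtain ⟨J, hJ⟩ := h.exists_right_inv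
  refine le_antisymm mul_one_div_le_one ?_
  have : J ≤ 1 / I := le_div_iff_mul_le.2 (by rw [mul_comm, hJ])
  calc (1 : Submodule T K) = I * J := hJ.symm
    _ ≤ _ := mul_le_mul_right this I

theorem isUnit_of_forall_exists {I : Submodule T K}
    (h : ∀ p : Ideal T, p.IsMaximal → ∃ r : T, r ∉ p ∧ (r : K) ∈ I * (1 / I)) : IsUnit I := by
  rw [isUnit_iff_mul_one_div]
  refine le_antisymm mul_one_div_le_one ?_
  by_contra hle
  let J : Ideal T := (I * (1 / I)).comap (Algebra.linearMap T K)
  have hJ : J ≠ ⊤ := by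
    intro hJ
    have : (1 : T) ∈ J := hJ ▸ mem_top
    refine hle (Submodule.one_le.2 ?_)
    simpa [J] using this
  obtain ⟨p, hp, hJp⟩ := Ideal.exists_le_maximal J hJ
  obtain ⟨r, hr, hrI⟩ := h p hp
  exact hr (hJp hrI)

/-- Nakayama for I modulo Ta gives r ≡ 1 mod p with rI ⊆ Ta; then r/a lies in (T:I), and r = a ·
(r/a). -/
theorem exists_mem_mul_one_div_of_le_sup {I : Submodule T K} (hI : I.FG) (hI0 : I ≠ ⊥)
    {p : Ideal T} (hp : p ≠ ⊤) {a : K} (ha : a ∈ I) (h : I ≤ span T {a} ⊔ p • I) :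
    ∃ r : T, r ∉ p ∧ (r : K) ∈ I * (1 / I) := by
  obtain ⟨r, hr, hr'⟩ := exists_sub_one_mem_and_smul_eq_zero_of_fg_of_le_smul p
    (I.map (span T {a}).mkQ) (hI.map _) (by
      rw [← map_smul'']
      refine (map_mono h).trans ?_
      rw [Submodule.map_sup]
      refine sup_le ?_ le_rfl
      rw [map_span_le]
      rintro x rfl
      rw [mkQ_apply, (Quotient.mk_eq_zero _).2 (mem_span_singleton_self x)]
      exact zero_mem _)
  have hrp : r ∉ p := fun hrp => by
    have := p.sub_mem hrp hr
    rw [sub_sub_cancel] at this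
    exact hp ((Ideal.eq_top_iff_one p).2 this)
  have hrI : ∀ x ∈ I, r • x ∈ span T {a} := by
    intro x hx
    have := hr' _ (mem_map_of_mem hx)
    rw [← map_smul] at this
    exact (Quotient.mk_eq_zero _).1 this
  have hr0 : (r : K) ≠ 0 := by
    intro h0
    have : r = 0 := Subtype.ext h0
    exact hrp (this ▸ p.zero_mem)
  have ha0 : a ≠ 0 := by
    rintro rfl
    obtain ⟨b, hb, hb0⟩ := Submodule.exists_mem_ne_zero_of_ne_bot hI0
    have := hrI b hb
    rw [span_zero_singleton, mem_bot, Subring.smul_def, smul_eq_mul] at this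
    exact (mul_ne_zero hr0 hb0) this
  refine ⟨r, hrp, ?_⟩
  have : (r : K) / a ∈ 1 / I := by
    rw [mem_div_iff_forall_mul_mem]
    intro y hy
    obtain ⟨t, ht⟩ := mem_span_singleton.1 (hrI y hy)
    rw [mem_one_iff]
    convert t.2 using 1
    rw [Subring.smul_def, Subring.smul_def, smul_eq_mul, smul_eq_mul] at ht
    rw [div_mul_eq_mul_div, ← ht, mul_div_cancel_right₀ _ ha0]
  have := mul_mem_mul ha this
  rwa [mul_div_cancel₀ _ ha0] at this

/-- The cyclic module (Ta + A)/A is T modulo the annihilator of the class of a. -/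
theorem index_span_singleton_sup (A C : Submodule T K) (a : K)
    (hC : ∀ t : T, (t : K) ∈ C ↔ t • a ∈ A) :
    index A (span T {a} ⊔ A) = index C 1 := by
  have hcomap : A.toAddSubgroup.comap (AddMonoidHom.mulRight a) ⊓ (1 : Submodule T K).toAddSubgroup =
      C.toAddSubgroup ⊓ (1 : Submodule T K).toAddSubgroup := by
    ext x
    refine and_congr_left fun hx1 => ?_
    obtain ⟨t, rfl⟩ : ∃ t : T, (t : K) = x := ⟨⟨x, mem_one_iff.1 hx1⟩, rfl⟩
    exact (hC t).symm
  have hmap : (span T {a}).toAddSubgroup =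
      (1 : Submodule T K).toAddSubgroup.map (AddMonoidHom.mulRight a) := by
    ext x
    rw [mem_toAddSubgroup, mem_span_singleton, AddSubgroup.mem_map]
    constructor
    · rintro ⟨t, rfl⟩
      exact ⟨t, mem_one_iff.2 t.2, rfl⟩
    · rintro ⟨t, ht, rfl⟩
      exact ⟨⟨t, mem_one_iff.1 ht⟩, rfl⟩
  rw [index, sup_toAddSubgroup, AddSubgroup.relIndex_sup_right, hmap, ← AddSubgroup.relIndex_comap,
    ← AddSubgroup.inf_relIndex_right, hcomap, AddSubgroup.inf_relIndex_right]

/-- B/A is a vector space over T/p with at most |T/p| elements, so any nonzero class spans it. -/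
theorem le_span_sup_of_index_le (hT : IsOrder T) {A B : Submodule T K} (hB : B.FG) (hA0 : A ≠ ⊥)
    (hAB : A ≤ B) {p : Ideal T} (hp : p.IsMaximal) (hp0 : p ≠ ⊥) (hpB : p • B ≤ A)
    (h : index A B ≤ index (coeSubmodule K p) 1) {b : K} (hb : b ∈ B) (hbA : b ∉ A) :
    B ≤ span T {b} ⊔ A := by
  have h₁ : index A (span T {b} ⊔ A) = index (coeSubmodule K p) 1 := by
    let q : Ideal T := A.comap (LinearMap.toSpanSingleton T K b)
    have hq : q = p := by
      refine (hp.eq_of_le (fun hq => hbA ?_) fun t ht => hpB (smul_mem_smul ht hb)).symm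
      have : (1 : T) ∈ q := hq ▸ mem_top
      simpa [q] using this
    refine index_span_singleton_sup _ _ _ fun t => ?_
    rw [mem_coeSubmodule_iff, show t ∈ p ↔ t ∈ q by rw [hq]]
    rfl
  have h₂ := index_mul_index (le_sup_right : A ≤ span T {b} ⊔ A)
    (sup_le ((span_singleton_le_iff_mem _ _).2 hb) hAB)
  rw [h₁] at h₂
  rw [← h₂] at h
  have hpos := Nat.pos_of_ne_zero (index_ne_zero hT fg_one (coeSubmodule_ne_bot hp0))
  have h₃ : index (span T {b} ⊔ A) B ≤ 1 := Nat.le_of_mul_le_mul_left (by simpa using h) hpos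
  have h₄ : index (span T {b} ⊔ A) B ≠ 0 := index_ne_zero hT hB (ne_bot_of_le le_sup_right hA0)
  exact index_eq_one.1 (by omega)

theorem mul_ne_bot {I J : Submodule T K} (hI : I ≠ ⊥) (hJ : J ≠ ⊥) : I * J ≠ ⊥ := fun h =>
  (Submodule.mul_eq_bot.1 h).elim hI hJ

theorem exists_le_span_sup_of_index_le (hT : IsOrder T) {I : Submodule T K} (hI : I.FG)
    (hI0 : I ≠ ⊥) {p : Ideal T} (hp : p.IsMaximal) (hp0 : p ≠ ⊥)
    (h : index (p • I) I ≤ index (coeSubmodule K p) 1) :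
    ∃ a ∈ I, I ≤ span T {a} ⊔ p • I := by
  by_cases hle : I ≤ p • I
  · exact ⟨0, zero_mem _, hle.trans le_sup_right⟩
  obtain ⟨a, ha, hap⟩ := SetLike.not_le_iff_exists.1 hle
  refine ⟨a, ha, le_span_sup_of_index_le hT hI ?_ smul_le_right hp hp0 le_rfl h ha hap⟩
  rw [smul_eq_coeSubmodule_mul]
  exact mul_ne_bot (coeSubmodule_ne_bot hp0) hI0

theorem IsOrder.not_isField (hT : IsOrder T) : ¬ IsField T := by
  intro h
  have := hT.finite
  exact Int.not_isField (isField_of_isIntegral_of_isField (R := ℤ) (S := T)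
    (RingHom.injective_int (algebraMap ℤ T)) h)

theorem discrepancy_eq_one_iff (hT : IsOrder T) {I : Submodule T K} (hI : I.FG) (hI0 : I ≠ ⊥) :
    discrepancy I = 1 ↔ index I (maximalOrder T * I) = index 1 (maximalOrder T) := by
  have : (index I (maximalOrder T * I) : ℚ) ≠ 0 := by
    exact_mod_cast index_ne_zero hT (fg_maximalOrder.mul hI) hI0
  rw [discrepancy_eq hT hI hI0, div_eq_one_iff_eq this, Nat.cast_inj, eq_comm]

/-- Lattices of discrepancy one are invertible. -/
theorem isUnit_of_discrepancy_eq_one (hT : IsOrder T) {I : Submodule T K} (hI : I.FG)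
    (hI0 : I ≠ ⊥) (h : discrepancy I = 1) : IsUnit I := by
  refine isUnit_of_forall_exists fun p hp => ?_
  have hp0 : p ≠ ⊥ := Ring.ne_bot_of_isMaximal_of_not_isField hp hT.not_isField
  obtain ⟨a, ha, hle⟩ := exists_le_span_sup_of_index_le hT hI hI0 hp hp0 (by
    rw [smul_eq_coeSubmodule_mul]
    exact index_mul_self_le hT hI hI0 ((discrepancy_eq_one_iff hT hI hI0).1 h)
      (coeSubmodule_ne_bot hp0) (coeSubmodule_le_one p))
  exact exists_mem_mul_one_div_of_le_sup hI hI0 hp.ne_top ha hle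

theorem mul_le_mul_iff_of_isUnit {P : Submodule T K} (hP : IsUnit P) {A B : Submodule T K} :
    P * A ≤ P * B ↔ A ≤ B := by
  refine ⟨fun h => ?_, fun h => mul_le_mul_right h P⟩
  obtain ⟨Q, hQ⟩ := hP.exists_left_inv
  have := mul_le_mul_right h Q
  rwa [← mul_assoc, ← mul_assoc, hQ, one_mul, one_mul] at this

theorem mul_covBy_mul_of_isUnit {P : Submodule T K} (hP : IsUnit P) {A B : Submodule T K}
    (h : A ⋖ B) : P * A ⋖ P * B := by
  obtain ⟨Q, hQ⟩ := hP.exists_right_inv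
  refine ⟨lt_of_le_not_ge (mul_le_mul_right h.le P)
    fun h' => h.lt.not_ge ((mul_le_mul_iff_of_isUnit hP).1 h'), fun C hC hC' => ?_⟩
  have e : C = P * (Q * C) := by rw [← mul_assoc, hQ, one_mul]
  rw [e] at hC hC'
  refine h.2 (c := Q * C) ?_ ?_
  · exact lt_of_le_not_ge ((mul_le_mul_iff_of_isUnit hP).1 hC.le)
      fun h' => hC.not_ge (mul_le_mul_right h' P)
  · exact lt_of_le_not_ge ((mul_le_mul_iff_of_isUnit hP).1 hC'.le)
      fun h' => hC'.not_ge (mul_le_mul_right h' P)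

/-- The index of a maximal submodule is determined by the annihilator of the quotient. -/
theorem index_eq_index_div_of_covBy {A B : Submodule T K} (h : A ⋖ B) :
    index A B = index (A / B) 1 := by
  obtain ⟨b, hb, hbA⟩ := SetLike.exists_of_lt h.lt
  have hB : span T {b} ⊔ A = B := by
    refine (h.eq_or_eq le_sup_right
      (sup_le ((span_singleton_le_iff_mem _ _).2 hb) h.le)).resolve_left fun he => hbA ?_
    exact he ▸ (mem_sup_left (mem_span_singleton_self b) : b ∈ span T {b} ⊔ A)
  conv_lhs => rw [← hB]
  refine index_span_singleton_sup _ _ _ fun t => ?_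
  rw [mem_div_iff_forall_mul_mem]
  refine ⟨fun ht => ht b hb, fun ht y hy => ?_⟩
  rw [← hB] at hy
  obtain ⟨u, hu, v, hv, rfl⟩ := mem_sup.1 hy
  obtain ⟨s, rfl⟩ := mem_span_singleton.1 hu
  rw [mul_add, mul_smul_comm]
  exact add_mem (A.smul_mem s ht) (A.smul_mem t hv)

theorem exists_covBy_le_of_index_ne_zero {A B : Submodule T K} (h : A < B) (h0 : index A B ≠ 0) :
    ∃ C, A ⋖ C ∧ C ≤ B := by
  obtain ⟨C, ⟨hAC, hCB⟩, hmin⟩ := (measure (index A)).wf.has_min {C | A < C ∧ C ≤ B} ⟨B, h, le_rfl⟩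
  refine ⟨C, ⟨hAC, fun D hAD hDC => hmin D ⟨hAD, hDC.le.trans hCB⟩ ?_⟩, hCB⟩
  have h₁ := index_mul_index hAC.le hCB
  have h₂ := index_mul_index hAD.le hDC.le
  have h₃ : index A C ≠ 0 := fun h' => h0 (by rw [← h₁, h', zero_mul])
  have h₄ : index D C ≠ 1 := fun h' => hDC.not_ge (index_eq_one.1 h')
  rw [← h₂] at h₃
  change index A D < index A C
  rw [← h₂]
  have := Nat.pos_of_ne_zero (left_ne_zero_of_mul h₃)
  have := Nat.pos_of_ne_zero (right_ne_zero_of_mul h₃)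
  nlinarith [show 2 ≤ index D C by omega]

/-- Multiplication by an invertible submodule preserves indices. -/
theorem index_mul_mul_of_isUnit {P : Submodule T K} (hP : IsUnit P) {A B : Submodule T K}
    (hAB : A ≤ B) (h0 : index A B ≠ 0) : index (P * A) (P * B) = index A B := by
  induction hn : index A B using Nat.strong_induction_on generalizing A with
  | _ n ih =>
    rcases hAB.eq_or_lt with rfl | hlt
    · rw [← hn, index_eq_one.2 le_rfl, index_eq_one.2 le_rfl]
    obtain ⟨C, hAC, hCB⟩ := exists_covBy_le_of_index_ne_zero hlt h0
    have h₁ := index_mul_index hAC.le hCB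
    have h₂ := index_mul_index (mul_le_mul_right hAC.le P) (mul_le_mul_right hCB P)
    have h₃ : index A C ≠ 1 := fun h' => hAC.lt.not_ge (index_eq_one.1 h')
    have h₄ : index C B ≠ 0 := fun h' => h0 (by rw [← h₁, h', mul_zero])
    have h₅ : index A C ≠ 0 := fun h' => h0 (by rw [← h₁, h', zero_mul])
    have hlt' : index C B < n := by
      rw [← hn, ← h₁]
      have := Nat.pos_of_ne_zero h₄
      nlinarith [show 2 ≤ index A C by omega]
    -- Multiplication by P preserves the annihilator of C/A, and that annihilator determines the
    -- index of a simple quotient.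
    have h₆ : (P * A) / (P * C) = A / C := by
      ext x
      rw [← span_singleton_le_iff_mem, ← span_singleton_le_iff_mem,
        Submodule.le_div_iff_mul_le, Submodule.le_div_iff_mul_le, mul_left_comm, mul_le_mul_iff_of_isUnit hP]
    rw [← h₂, ih _ hlt' hCB h₄ rfl, index_eq_index_div_of_covBy (mul_covBy_mul_of_isUnit hP hAC),
      h₆, ← index_eq_index_div_of_covBy hAC, h₁, hn]

theorem discrepancy_mul_of_isUnit (hT : IsOrder T) {P I : Submodule T K} (hP : IsUnit P)
    (hPfg : P.FG) (hI : I.FG) (hI0 : I ≠ ⊥) : discrepancy (P * I) = discrepancy I := by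
  have h0 : P * I ≠ ⊥ := by
    intro h
    obtain ⟨Q, hQ⟩ := hP.exists_left_inv
    have := congrArg (Q * ·) h
    simp only [← mul_assoc, hQ, one_mul, mul_bot] at this
    exact hI0 this
  rw [discrepancy_eq hT (hPfg.mul hI) h0, discrepancy_eq hT hI hI0, mul_left_comm,
    index_mul_mul_of_isUnit hP (le_maximalOrder_mul hT I)
      (index_ne_zero hT (fg_maximalOrder.mul hI) hI0)]

theorem discrepancy_one (hT : IsOrder T) : discrepancy (1 : Submodule T K) = 1 := by
  rw [discrepancy_eq_one_iff hT fg_one one_ne_bot, mul_one]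

theorem IsOrder.fg_of_le (hT : IsOrder T) {A B : Submodule T K} (hB : B.FG) (h : A ≤ B) : A.FG := by
  have := hT.isNoetherianRing
  have : IsNoetherian T B := isNoetherian_of_fg_of_noetherian B hB
  have hfg := (IsNoetherian.noetherian (A.submoduleOf B)).map B.subtype
  rwa [submoduleOf, map_comap_subtype, inf_eq_right.2 h] at hfg

theorem discrepancy_eq_one_of_isUnit (hT : IsOrder T) {I : Submodule T K} (h : IsUnit I)
    (hI : I.FG) : discrepancy I = 1 := by
  simpa [discrepancy_one hT] using discrepancy_mul_of_isUnit hT h hI fg_one one_ne_bot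

/-- A splitting of the free module on P over P gives coordinate functionals P → T. Each is
multiplication by an element of (T:P), and the dual basis identity at b, divided by b, writes 1 as
an element of P(T:P). -/
theorem isUnit_of_projective (hT : IsOrder T) {P : Submodule T K} (hP0 : P ≠ ⊥)
    [Module.Projective T P] : IsUnit P := by
  rw [isUnit_iff_mul_one_div]
  refine le_antisymm mul_one_div_le_one (Submodule.one_le.2 ?_)
  obtain ⟨s, hs⟩ := Module.projective_def'.1 (inferInstance : Module.Projective T P)
  obtain ⟨b, hb, hb0⟩ := Submodule.exists_mem_ne_zero_of_ne_bot hP0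
  let b' : P := ⟨b, hb⟩
  -- P has rank one: some nonzero multiple ny is a T-multiple of b, so a linear functional is
  -- determined by its value at b.
  have hmul : ∀ x y : P, (s b' x : K) / b * y = s y x := by
    intro x y
    obtain ⟨n, hn, hny⟩ := hT.exists_nat_mul_mem (y / b)
    have hn' : (n : K) ≠ 0 := by exact_mod_cast hn
    have e : (n : T) • y = (⟨_, hny⟩ : T) • b' := by
      ext
      simp only [b', SetLike.val_smul, Subring.smul_def, smul_eq_mul]
      push_cast
      field_simp
    have e' := congrArg (fun z => ((s z x : T) : K)) e
    simp only [map_smul, Finsupp.smul_apply, smul_eq_mul, Subring.coe_mul] at e'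
    push_cast at e'
    rw [← mul_right_inj' hn', e']
    field_simp
  have hsum : ((Finsupp.linearCombination T id (s b') : P) : K) = b :=
    congrArg Subtype.val (LinearMap.congr_fun hs b')
  rw [Finsupp.linearCombination_apply, Finsupp.sum, AddSubmonoidClass.coe_finsetSum] at hsum
  have h1 : (1 : K) = ∑ x ∈ (s b').support, (x : K) * ((s b' x : K) / b) := by
    rw [← div_self hb0]
    nth_rewrite 1 [← hsum]
    rw [Finset.sum_div]
    refine Finset.sum_congr rfl fun x _ => ?_
    simp only [id, SetLike.val_smul, Subring.smul_def, smul_eq_mul]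
    ring
  rw [h1]
  refine sum_mem fun x _ => mul_mem_mul x.2 (mem_div_iff_forall_mul_mem.2 fun y hy => ?_)
  rw [hmul x ⟨y, hy⟩]
  exact mem_one_iff.2 (s ⟨y, hy⟩ x).2

end Invertible

end

section

variable {K : Type*} [Field K] [NumberField K] {T : Subring K}

/-! ### Trace duality, the different and multiplier rings. -/

section Dual

open Submodule

/-- The dual of a submodule of `K` for the trace form. -/
noncomputable abbrev dual (I : Submodule T K) : Submodule T K := traceDual ℤ ℚ I

theorem exists_basis_span_eq (hT : IsOrder T) {I : Submodule T K} (hI : I.FG) (hI0 : I ≠ ⊥) :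
    ∃ (n : ℕ) (b : Module.Basis (Fin n) ℚ K), I.restrictScalars ℤ = span ℤ (Set.range b) := by
  have : Module.Finite ℤ (I.restrictScalars ℤ) := hT.finite_int hI
  let b := Module.finBasis ℤ (I.restrictScalars ℤ)
  have hspan : span ℤ (Set.range fun i => (b i : K)) = I.restrictScalars ℤ := by
    have h : Set.range (fun i => (b i : K)) = (I.restrictScalars ℤ).subtype '' Set.range b := by
      rw [← Set.range_comp]
      rfl
    rw [h, ← map_span, b.span_eq, Submodule.map_top, range_subtype]
  have hli : LinearIndependent ℤ (fun i => (b i : K)) :=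
    b.linearIndependent.map' (I.restrictScalars ℤ).subtype (ker_subtype _)
  have hspan' : ⊤ ≤ span ℚ (Set.range fun i => (b i : K)) := by
    intro x _
    obtain ⟨n, hn, hnx⟩ := exists_nat_mul_mem_submodule hT hI0 x
    have h₁ : (n : K) * x ∈ span ℚ (Set.range fun i => (b i : K)) :=
      span_le_restrictScalars ℤ ℚ _ (hspan.ge hnx)
    have h₂ := smul_mem (span ℚ (Set.range fun i => (b i : K))) (n : ℚ)⁻¹ h₁
    rw [Rat.smul_def] at h₂
    have hn' : (n : K) ≠ 0 := by exact_mod_cast hn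
    push_cast at h₂
    rwa [inv_mul_cancel_left₀ hn'] at h₂
  refine ⟨_, Module.Basis.mk (LinearIndependent.iff_fractionRing (R := ℤ) (K := ℚ) |>.1 hli) hspan',
    ?_⟩
  rw [Module.Basis.coe_mk, hspan]

theorem dual_dual (hT : IsOrder T) {I : Submodule T K} (hI : I.FG) (hI0 : I ≠ ⊥) :
    dual (dual I) = I := by
  obtain ⟨n, b, hb⟩ := exists_basis_span_eq hT hI hI0
  refine restrictScalars_injective ℤ T K ?_
  rw [restrictScalars_traceDual, restrictScalars_traceDual, hb]
  exact LinearMap.BilinForm.dualSubmodule_dualSubmodule_of_basis _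
    (traceForm_nondegenerate ℚ K) (Algebra.traceForm_isSymm ℚ) b

theorem fg_dual (hT : IsOrder T) {I : Submodule T K} (hI : I.FG) (hI0 : I ≠ ⊥) :
    (dual I).FG := by
  classical
  obtain ⟨n, b, hb⟩ := exists_basis_span_eq hT hI hI0
  have h := traceDual_span_of_basis ℤ (K := ℚ) I b hb
  have hfg : (span ℤ (Set.range b.traceDual)).FG := fg_span (Set.finite_range _)
  rw [← h] at hfg
  exact FG.of_restrictScalars ℤ hfg

theorem le_dual_iff {I J : Submodule T K} : I ≤ dual J ↔ I * J ≤ dual 1 := le_traceDual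

theorem dual_mul {I J : Submodule T K} : dual (I * J) = dual J / I := by
  refine eq_of_forall_le_iff fun X => ?_
  rw [Submodule.le_div_iff_mul_le]
  exact le_traceDual_mul_iff

theorem dual_anti {I J : Submodule T K} (h : I ≤ J) : dual J ≤ dual I := by
  rw [le_dual_iff]
  exact (mul_le_mul_right h _).trans (le_dual_iff.1 le_rfl)

theorem one_le_dual_one (hT : IsOrder T) : (1 : Submodule T K) ≤ dual 1 := by
  refine Submodule.one_le.2 (mem_traceDual.2 fun a ha => ?_)
  rw [Algebra.traceForm_apply, one_mul]
  have : IsIntegral ℤ (Algebra.trace ℚ K a) :=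
    Algebra.isIntegral_trace (hT.isIntegral (mem_one_iff.1 ha))
  obtain ⟨y, hy⟩ := IsIntegrallyClosed.isIntegral_iff.1 this
  exact ⟨y, hy⟩

theorem dual_one_ne_bot (hT : IsOrder T) : dual (1 : Submodule T K) ≠ ⊥ :=
  ne_bot_of_le (one_le_dual_one hT) one_ne_bot

theorem dual_ne_bot (hT : IsOrder T) {I : Submodule T K} (hI : I.FG) : dual I ≠ ⊥ := by
  obtain ⟨n, hn, h⟩ := exists_nat_forall_mul_mem hT hI one_ne_bot
  refine (Submodule.ne_bot_iff _).2 ⟨n, ?_, by exact_mod_cast hn⟩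
  rw [← span_singleton_le_iff_mem, le_dual_iff]
  refine le_trans (mul_le.2 fun x hx y hy => ?_) (one_le_dual_one hT)
  obtain ⟨t, rfl⟩ := mem_span_singleton.1 hx
  rw [smul_mul_assoc]
  exact smul_mem _ _ (h y hy)

theorem dual_one_div_self (hT : IsOrder T) : dual (1 : Submodule T K) / dual 1 = 1 := by
  rw [← dual_mul, mul_one, dual_dual hT fg_one one_ne_bot]

/-- The dual of J J^∨ is (J^∨∨ : J) = (J:J) = T; dualize once more. -/
theorem mul_dual_self (hT : IsOrder T) {J : Submodule T K} (hJ : J.FG) (hJ0 : J ≠ ⊥)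
    (h : J / J = 1) : J * dual J = dual 1 := by
  have hfg := hJ.mul (fg_dual hT hJ hJ0)
  have h0 := mul_ne_bot hJ0 (dual_ne_bot hT hJ)
  rw [← dual_dual hT hfg h0, dual_mul, dual_dual hT hJ hJ0, h]

theorem isUnit_of_div_self_eq_one (hT : IsOrder T) (hW : IsUnit (dual (1 : Submodule T K)))
    {J : Submodule T K} (hJ : J.FG) (hJ0 : J ≠ ⊥) (h : J / J = 1) : IsUnit J := by
  rw [← mul_dual_self hT hJ hJ0 h] at hW
  exact isUnit_of_mul_isUnit_left hW

theorem div_self_eq_one_of_isUnit {J : Submodule T K} (h : IsUnit J) : J / J = 1 := by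
  refine eq_of_forall_le_iff fun X => ?_
  rw [Submodule.le_div_iff_mul_le, ← mul_le_mul_iff_of_isUnit h (B := 1), mul_one, mul_comm]

/-- Nakayama yields r ≡ 1 mod X killing T^∨. Since 1 ∈ T^∨, r = 0 and hence 1 ∈ X. -/
theorem eq_one_of_dual_one_mul_eq (hT : IsOrder T) {X : Submodule T K} (hX : X ≤ 1)
    (h : dual 1 * X = dual 1) : X = 1 := by
  refine le_antisymm hX (Submodule.one_le.2 ?_)
  let J : Ideal T := X.comap (Algebra.linearMap T K)
  have hJ : IsLocalization.coeSubmodule K J = X := by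
    refine (map_comap_eq _ _).trans (inf_eq_right.2 ?_)
    rwa [← Submodule.one_eq_range]
  obtain ⟨r, hr, h0⟩ := exists_sub_one_mem_and_smul_eq_zero_of_fg_of_le_smul J (dual 1)
    (fg_dual hT fg_one one_ne_bot) (by rw [smul_eq_coeSubmodule_mul, hJ, mul_comm, h])
  have := h0 1 (one_le_dual_one hT one_mem_one)
  rw [Subring.smul_def, smul_eq_mul, mul_one] at this
  have hr0 : r = 0 := Subtype.ext this
  rw [hr0, zero_sub, neg_mem_iff] at hr
  exact hr

/-- Put W = T^∨, D = (T:W) and X = WD. Then (T:X) = (D:D) = T because D is invertible. As (XW)^∨ =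
(T:X), dualizing gives XW = W, whence X = T. -/
theorem isUnit_dual_one_of_isUnit_different (hT : IsOrder T) (h : IsUnit (different T)) :
    IsUnit (dual (1 : Submodule T K)) := by
  set D := different T
  have hD : D = 1 / dual 1 := rfl
  set X := dual 1 * D
  have hX1 : X ≤ 1 := mul_one_div_le_one
  have hX : 1 / X = 1 := by
    refine Eq.trans (eq_of_forall_le_iff fun Y => ?_) (div_self_eq_one_of_isUnit h)
    have e₁ : Y ≤ 1 / X ↔ Y * X ≤ 1 := Submodule.le_div_iff_mul_le
    have e₂ : Y ≤ D / D ↔ Y * D ≤ D := Submodule.le_div_iff_mul_le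
    have e₃ : Y * D ≤ 1 / dual 1 ↔ Y * D * dual 1 ≤ 1 := Submodule.le_div_iff_mul_le
    rw [← hD] at e₃
    rw [e₁, e₂, e₃, mul_assoc, mul_comm D]
  have hWfg := fg_dual hT (T := T) fg_one one_ne_bot
  have hX0 : X ≠ ⊥ := by
    refine mul_ne_bot (dual_one_ne_bot hT) fun h0 => ?_
    rw [h0] at h
    obtain ⟨Q, hQ⟩ := h.exists_right_inv
    rw [bot_mul] at hQ
    exact one_ne_bot hQ.symm
  have hXfg : X.FG := hT.fg_of_le fg_one hX1
  have e : dual 1 * X = dual 1 := by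
    rw [← dual_dual hT (hWfg.mul hXfg) (mul_ne_bot (dual_one_ne_bot hT) hX0), mul_comm, dual_mul,
      dual_dual hT fg_one one_ne_bot, hX]
  exact IsUnit.of_mul_eq_one _ (eq_one_of_dual_one_mul_eq hT hX1 e)

theorem different_le_one (hT : IsOrder T) : different T ≤ 1 := by
  intro x hx
  have := mem_div_iff_forall_mul_mem.1 hx 1 (one_le_dual_one hT one_mem_one)
  rwa [mul_one] at this

theorem different_ne_bot (hT : IsOrder T) : different T ≠ ⊥ := by
  obtain ⟨n, hn, h⟩ := exists_nat_forall_mul_mem hT (fg_dual hT (T := T) fg_one one_ne_bot)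
    one_ne_bot
  exact (Submodule.ne_bot_iff _).2 ⟨n, mem_div_iff_forall_mul_mem.2 h, by exact_mod_cast hn⟩

theorem discrepancy_different_eq_one_iff (hT : IsOrder T) :
    discrepancy (different T) = 1 ↔ IsUnit (dual (1 : Submodule T K)) := by
  have hfg := hT.fg_of_le fg_one (different_le_one hT)
  constructor
  · intro h
    exact isUnit_dual_one_of_isUnit_different hT
      (isUnit_of_discrepancy_eq_one hT hfg (different_ne_bot hT) h)
  · intro h
    refine discrepancy_eq_one_of_isUnit hT ?_ hfg
    have := isUnit_iff_mul_one_div.1 h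
    exact IsUnit.of_mul_eq_one _ ((mul_comm _ _).trans this)

theorem forall_discrepancy_eq_one_iff (hT : IsOrder T) :
    (∀ J : Submodule T K, J ≤ 1 → J ≠ ⊥ → (discrepancy J = 1 ↔ 1 = J / J)) ↔
      IsUnit (dual (1 : Submodule T K)) := by
  constructor
  · intro h
    have hWfg := fg_dual hT (T := T) fg_one one_ne_bot
    -- The test ideal is nT^∨: scaling puts T^∨ inside T and keeps its multiplier ring T.
    obtain ⟨n, hn, hn1⟩ := exists_nat_forall_mul_mem hT hWfg one_ne_bot
    have hn' : (n : K) ≠ 0 := by exact_mod_cast hn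
    have hJ1 : natMul n (dual (1 : Submodule T K)) ≤ 1 := by
      rintro _ ⟨x, hx, rfl⟩
      exact hn1 x hx
    have hJ0 := natMul_ne_bot hn (dual_one_ne_bot hT)
    have hunit : IsUnit (natMul n (1 : Submodule T K)) := by
      refine IsUnit.of_mul_eq_one (span T {(n : K)⁻¹}) ?_
      have : natMul n (1 : Submodule T K) = span T {(n : K)} := by
        rw [natMul, Submodule.one_eq_span, map_span]
        simp
      rw [this, span_mul_span, Set.singleton_mul_singleton, mul_inv_cancel₀ hn',
        Submodule.one_eq_span]
    have e : natMul n (dual (1 : Submodule T K)) = natMul n 1 * dual 1 := by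
      rw [← natMul_mul, one_mul]
    have hdiv : natMul n (dual (1 : Submodule T K)) / natMul n (dual 1) = 1 := by
      refine Eq.trans (eq_of_forall_le_iff fun X => ?_) (dual_one_div_self hT)
      rw [e]
      rw [Submodule.le_div_iff_mul_le, Submodule.le_div_iff_mul_le, mul_left_comm,
        mul_le_mul_iff_of_isUnit hunit]
    have hu := isUnit_of_discrepancy_eq_one hT (hT.fg_of_le fg_one hJ1) hJ0
      ((h _ hJ1 hJ0).2 hdiv.symm)
    rw [e] at hu
    exact isUnit_of_mul_isUnit_right hu
  · intro hW J hJ1 hJ0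
    have hfg := hT.fg_of_le fg_one hJ1
    constructor
    · intro h
      exact (div_self_eq_one_of_isUnit (isUnit_of_discrepancy_eq_one hT hfg hJ0 h)).symm
    · intro h
      exact discrepancy_eq_one_of_isUnit hT
        (isUnit_of_div_self_eq_one hT hW hfg hJ0 h.symm) hfg

/-- If `(T : p) / T` is at most one-dimensional over `T / p`, then the dual of `T` is
locally generated at `p` by one element. -/
theorem exists_notMem_of_index_le (hT : IsOrder T) {p : Ideal T} (hp : p.IsMaximal) (hp0 : p ≠ ⊥)
    (h : index 1 (1 / IsLocalization.coeSubmodule K p) ≤ index (IsLocalization.coeSubmodule K p) 1) :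
    ∃ r : T, r ∉ p ∧ (r : K) ∈ (dual 1 * (1 / dual 1) : Submodule T K) := by
  set P := IsLocalization.coeSubmodule K p
  have hWfg := fg_dual hT (T := T) fg_one one_ne_bot
  have hW0 := dual_one_ne_bot hT
  have hP0 : P ≠ ⊥ := coeSubmodule_ne_bot hp0
  have hP1 : P ≤ 1 := coeSubmodule_le_one p
  have hPW : (P * dual 1).FG := (hT.fg_of_le fg_one hP1).mul hWfg
  have hPW0 : P * dual 1 ≠ ⊥ := mul_ne_bot hP0 hW0
  have hPWle : P * dual 1 ≤ dual 1 := by simpa using mul_le_mul_left hP1 (dual 1)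
  -- Duality reverses the lattices between pT^∨ and T^∨ into those between T and (T:p). The dual of
  -- X = Ta + pT^∨ is therefore T, giving X = T^∨, or all of (T:p), which would put a in pT^∨.
  have hQ : dual (P * dual 1) = 1 / P := by
    rw [dual_mul, dual_dual hT fg_one one_ne_bot]
  suffices h : ∃ a ∈ dual 1, dual 1 ≤ span T {a} ⊔ p • dual 1 by
    obtain ⟨a, ha, hle⟩ := h
    exact exists_mem_mul_one_div_of_le_sup hWfg hW0 hp.ne_top ha hle
  rw [smul_eq_coeSubmodule_mul]
  by_cases hle : dual 1 ≤ P * dual 1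
  · exact ⟨0, zero_mem _, hle.trans le_sup_right⟩
  obtain ⟨a, ha, haP⟩ := SetLike.not_le_iff_exists.1 hle
  refine ⟨a, ha, ?_⟩
  set X := span T {a} ⊔ P * dual 1
  have hXW : X ≤ dual 1 := sup_le ((span_singleton_le_iff_mem _ _).2 ha) hPWle
  have hX : dual (dual X) = X := dual_dual hT (hT.fg_of_le hWfg hXW) (ne_bot_of_le le_sup_right hPW0)
  have h₁ : 1 ≤ dual X := by
    rw [← dual_dual hT fg_one one_ne_bot]
    exact dual_anti hXW
  have h₂ : dual X ≤ 1 / P := hQ ▸ dual_anti le_sup_right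
  by_cases hX1 : dual X ≤ 1
  · rw [← hX]
    exact dual_anti hX1
  obtain ⟨b, hb, hb1⟩ := SetLike.not_le_iff_exists.1 hX1
  have h₃ := le_span_sup_of_index_le hT (hQ ▸ fg_dual hT hPW hPW0) one_ne_bot (h₁.trans h₂) hp hp0
    (by rw [smul_eq_coeSubmodule_mul]; exact mul_one_div_le_one) h (h₂ hb) hb1
  have h₄ : 1 / P ≤ dual X := h₃.trans (sup_le ((span_singleton_le_iff_mem _ _).2 hb) h₁)
  have h₅ : X = P * dual 1 := by
    rw [← hX, ← dual_dual hT hPW hPW0, hQ, le_antisymm h₂ h₄]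
  exact absurd (h₅ ▸ mem_sup_left (mem_span_singleton_self a) : a ∈ P * dual 1) haP

end Dual

end

section

/-! ### Ext groups of finite modules over a local domain. -/

section InjectiveDimension

universe v

open CategoryTheory CategoryTheory.Abelian IsLocalRing

variable {R : Type v} [CommRing R]

/-- The short complex `0 → M → N → L → 0` of an exact pair of linear maps. -/
abbrev shortComplexOfExact {M N L : Type v} [AddCommGroup M] [AddCommGroup N] [AddCommGroup L]
    [Module R M] [Module R N] [Module R L] {f : M →ₗ[R] N} {g : N →ₗ[R] L}
    (h : Function.Exact f g) : ShortComplex (ModuleCat.{v} R) :=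
  ModuleCat.shortComplexOfCompEqZero f g h.linearMap_comp_eq_zero

theorem shortExact_shortComplexOfExact {M N L : Type v} [AddCommGroup M] [AddCommGroup N]
    [AddCommGroup L] [Module R M] [Module R N] [Module R L] {f : M →ₗ[R] N} {g : N →ₗ[R] L}
    (h : Function.Exact f g) (hf : Function.Injective f) (hg : Function.Surjective g) :
    (shortComplexOfExact h).ShortExact :=
  ModuleCat.shortComplex_shortExact _ h hf hg

instance projective_self : Projective (ModuleCat.of R R) :=
  (IsProjective.iff_projective R).1 inferInstance

theorem exact_mul_mkQ (x : R) :
    Function.Exact (LinearMap.mulLeft R x) (Ideal.span {x}).mkQ := by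
  intro y
  rw [Submodule.mkQ_apply, Submodule.Quotient.mk_eq_zero, Ideal.mem_span_singleton']
  exact ⟨fun ⟨a, ha⟩ => ⟨a, by rw [← ha]; exact mul_comm x a⟩,
    fun ⟨a, ha⟩ => ⟨a, by rw [← ha]; exact mul_comm a x⟩⟩

theorem exists_injective_of_finite [IsLocalRing R] (M : Type v) [AddCommGroup M] [Module R M]
    [Finite M] [Nontrivial M] :
    ∃ f : (R ⧸ maximalIdeal R) →ₗ[R] M, Function.Injective f := by
  have : IsArtinian R M := inferInstance
  obtain ⟨S, hS⟩ := IsAtomic.exists_atom (Submodule R M)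
  rw [← isSimpleModule_iff_isAtom, isSimpleModule_iff_quot_maximal] at hS
  obtain ⟨I, hI, ⟨e⟩⟩ := hS
  obtain rfl := eq_maximalIdeal hI
  exact ⟨S.subtype ∘ₗ e.symm.toLinearMap, S.injective_subtype.comp e.symm.injective⟩

theorem card_quotient_range {M N : Type v} [AddCommGroup M] [Module R M] [AddCommGroup N]
    [Module R N] (f : M →ₗ[R] N) (hf : Function.Injective f) :
    Nat.card N = Nat.card (N ⧸ LinearMap.range f) * Nat.card M := by
  rw [Submodule.card_eq_card_quotient_mul_card (LinearMap.range f), mul_comm]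
  congr 1
  exact Nat.card_congr (LinearEquiv.ofInjective f hf).toEquiv.symm

/-- Induction on finite modules over a local ring, by splitting off copies of the residue field. -/
theorem finite_module_induction [IsLocalRing R] [Finite (R ⧸ maximalIdeal R)]
    {motive : ModuleCat.{v} R → Prop}
    (subsingleton : ∀ (M : Type v) [AddCommGroup M] [Module R M] [Subsingleton M],
      motive (ModuleCat.of R M))
    (extension : ∀ (M : Type v) [AddCommGroup M] [Module R M] [Finite M]
      (f : (R ⧸ maximalIdeal R) →ₗ[R] M), Function.Injective f →
      motive (ModuleCat.of R (M ⧸ LinearMap.range f)) → motive (ModuleCat.of R M))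
    (M : Type v) [AddCommGroup M] [Module R M] [Finite M] : motive (ModuleCat.of R M) := by
  induction hn : Nat.card M using Nat.strong_induction_on generalizing M with
  | _ n ih =>
    rcases subsingleton_or_nontrivial M with hM | hM
    · exact subsingleton M
    obtain ⟨f, hf⟩ := exists_injective_of_finite (R := R) M
    have : Finite (M ⧸ LinearMap.range f) := Finite.of_surjective _ (Submodule.mkQ_surjective _)
    refine extension M f hf (ih _ ?_ _ rfl)
    rw [← hn, card_quotient_range f hf]
    have h₁ : 1 < Nat.card (R ⧸ maximalIdeal R) := Finite.one_lt_card
    have h₂ : 0 < Nat.card (M ⧸ LinearMap.range f) := Nat.card_pos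
    nlinarith

theorem ext_eq_zero_of_subsingleton {M : Type v} [AddCommGroup M] [Module R M] [Subsingleton M]
    {Y : ModuleCat.{v} R} {i : ℕ} (e : Ext (ModuleCat.of R M) Y i) : e = 0 := by
  rw [← Ext.mk₀_id_comp e, (ModuleCat.isZero_of_subsingleton (ModuleCat.of R M)).eq_of_src (𝟙 _) 0,
    Ext.mk₀_zero, Ext.zero_comp]

/-- R/x has the free resolution 0 → R → R of length one. -/
theorem ext_quotient_span_eq_zero [IsDomain R] {x : R} (hx : x ≠ 0) {i : ℕ} (Y : ModuleCat.{v} R)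
    (e : Ext (ModuleCat.of R (R ⧸ Ideal.span {x})) Y (i + 2)) : e = 0 := by
  have hS := shortExact_shortComplexOfExact (exact_mul_mkQ x) (mul_right_injective₀ hx)
    (Submodule.mkQ_surjective _)
  obtain ⟨y, rfl⟩ := Ext.contravariant_sequence_exact₃ hS Y e (Ext.eq_zero_of_projective _)
    (n₀ := i + 1) (by omega)
  rw [Ext.eq_zero_of_projective y, Ext.comp_zero]

/-- The residue field k embeds in R/x. Its Ext in degree i + 2 sits between that of R/x and the
degree i + 3 Ext of the finite cokernel, both zero; dévissage extends this from k to all finite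
modules. -/
theorem ext_finite_eq_zero_of_succ [IsLocalRing R] [IsDomain R] {x : R} (hx : x ≠ 0)
    (hxm : x ∈ maximalIdeal R) [Finite (R ⧸ Ideal.span {x})] (Y : ModuleCat.{v} R) {i : ℕ}
    (h : ∀ (M : Type v) [AddCommGroup M] [Module R M] [Finite M]
      (e : Ext (ModuleCat.of R M) Y (i + 3)), e = 0)
    (M : Type v) [AddCommGroup M] [Module R M] [Finite M]
    (e : Ext (ModuleCat.of R M) Y (i + 2)) : e = 0 := by
  have hle : Ideal.span {x} ≤ maximalIdeal R := (Ideal.span_singleton_le_iff_mem _).2 hxm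
  have : Finite (R ⧸ maximalIdeal R) :=
    Finite.of_surjective _ (Ideal.Quotient.factor_surjective hle)
  have : Nontrivial (R ⧸ Ideal.span {x}) :=
    Ideal.Quotient.nontrivial_iff.2 (ne_top_of_le_ne_top Ideal.IsPrime.ne_top' hle)
  have hk : ∀ e : Ext (ModuleCat.of R (R ⧸ maximalIdeal R)) Y (i + 2), e = 0 := by
    intro e
    obtain ⟨f, hf⟩ := exists_injective_of_finite (R := R) (R ⧸ Ideal.span {x})
    have : Finite ((R ⧸ Ideal.span {x}) ⧸ LinearMap.range f) :=
      Finite.of_surjective _ (Submodule.mkQ_surjective _)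
    have hS := shortExact_shortComplexOfExact f.exact_map_mkQ_range hf (Submodule.mkQ_surjective _)
    obtain ⟨y, rfl⟩ := Ext.contravariant_sequence_exact₁ hS Y e (n₁ := i + 3) (by omega) (h _ _)
    rw [ext_quotient_span_eq_zero hx Y y, Ext.comp_zero]
  refine finite_module_induction (motive := fun M => ∀ e : Ext M Y (i + 2), e = 0) ?_ ?_ M e
  · intro M _ _ _ e
    exact ext_eq_zero_of_subsingleton e
  · intro M _ _ _ f hf ih e
    have hS := shortExact_shortComplexOfExact f.exact_map_mkQ_range hf (Submodule.mkQ_surjective _)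
    obtain ⟨y, rfl⟩ := Ext.contravariant_sequence_exact₂ hS Y e (hk _)
    rw [ih y, Ext.comp_zero]

theorem ext_two_finite_eq_zero [IsLocalRing R] [IsDomain R] {x : R} (hx : x ≠ 0)
    (hxm : x ∈ maximalIdeal R) [Finite (R ⧸ Ideal.span {x})] (Y : ModuleCat.{v} R) {n : ℕ}
    [HasInjectiveDimensionLE Y n] (M : Type v) [AddCommGroup M] [Module R M] [Finite M]
    (e : Ext (ModuleCat.of R M) Y 2) : e = 0 := by
  have key : ∀ j i, j + i = n → ∀ (M : Type v) [AddCommGroup M] [Module R M] [Finite M]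
      (e : Ext (ModuleCat.of R M) Y (i + 2)), e = 0 := by
    intro j
    induction j with
    | zero =>
      intro i hi M _ _ _ e
      exact e.eq_zero_of_hasInjectiveDimensionLT (n + 1) (by omega)
    | succ j ih =>
      intro i hi
      exact ext_finite_eq_zero_of_succ hx hxm Y (ih (i + 1) (by omega))
  exact key n 0 (by omega) M e

theorem hom_eq_zero_of_finite [IsDomain R] [Infinite R] {M : Type v} [AddCommGroup M] [Module R M]
    [Finite M] (f : M →ₗ[R] R) : f = 0 := by
  ext m
  by_contra h
  have : Function.Injective fun r : R => f (r • m) := by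
    intro r s hrs
    refine mul_right_cancel₀ h ?_
    simpa using hrs
  exact not_injective_infinite_finite (fun r : R => r • m) fun r s hrs => this (congrArg f hrs)

variable (R) in
/-- The group `Ext¹(M, R)`. -/
abbrev ExtOne (M : Type v) [AddCommGroup M] [Module R M] : Type v :=
  Ext (ModuleCat.of R M) (ModuleCat.of R R) 1

/-- Hom(k, R) = 0 and Ext²(M/k, R) = 0 cut the long exact sequence down to a short one of Ext¹
groups. -/
theorem card_extOne_eq_mul [IsLocalRing R] [IsDomain R] [Infinite R]
    [Finite (R ⧸ maximalIdeal R)]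
    (h : ∀ (M : Type v) [AddCommGroup M] [Module R M] [Finite M]
      (e : Ext (ModuleCat.of R M) (ModuleCat.of R R) 2), e = 0)
    (M : Type v) [AddCommGroup M] [Module R M] [Finite M]
    (f : (R ⧸ maximalIdeal R) →ₗ[R] M) (hf : Function.Injective f) :
    Nat.card (ExtOne R M) =
      Nat.card (ExtOne R (M ⧸ LinearMap.range f)) * Nat.card (ExtOne R (R ⧸ maximalIdeal R)) := by
  have : Finite (M ⧸ LinearMap.range f) := Finite.of_surjective _ (Submodule.mkQ_surjective _)
  have hS := shortExact_shortComplexOfExact f.exact_map_mkQ_range hf (Submodule.mkQ_surjective _)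
  let α : ExtOne R (M ⧸ LinearMap.range f) →+ ExtOne R M :=
    (Ext.mk₀ (shortComplexOfExact f.exact_map_mkQ_range).g).precomp (ModuleCat.of R R) (zero_add 1)
  let β : ExtOne R M →+ ExtOne R (R ⧸ maximalIdeal R) :=
    (Ext.mk₀ (shortComplexOfExact f.exact_map_mkQ_range).f).precomp (ModuleCat.of R R) (zero_add 1)
  have hα : Function.Injective α := by
    rw [injective_iff_map_eq_zero]
    intro e he
    obtain ⟨y, rfl⟩ := Ext.contravariant_sequence_exact₃ hS _ e he (n₀ := 0) (by omega)
    have hy : y = 0 := by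
      rw [← Ext.mk₀_homEquiv₀_apply y]
      have : Ext.homEquiv₀ y = 0 := by
        ext1
        exact hom_eq_zero_of_finite _
      rw [this, Ext.mk₀_zero]
    rw [hy, Ext.comp_zero]
  have hβ : Function.Surjective β := by
    intro e
    exact Ext.contravariant_sequence_exact₁ hS _ e (n₁ := 2) (by omega) (h _ _)
  have hker : β.ker = α.range := by
    ext e
    constructor
    · intro he
      exact Ext.contravariant_sequence_exact₂ hS _ e he
    · rintro ⟨y, rfl⟩
      refine (Ext.mk₀_comp_mk₀_assoc _ _ y).trans ?_
      rw [ShortComplex.zero, Ext.mk₀_zero, Ext.zero_comp]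
  rw [← AddSubgroup.card_mul_index β.ker, AddSubgroup.index_ker, hker,
    AddMonoidHom.range_eq_top.2 hβ, AddSubgroup.card_top]
  congr 1
  exact (Nat.card_congr (AddMonoidHom.ofInjective hα).toEquiv).symm

theorem exists_card_eq_pow [IsLocalRing R] [IsDomain R] [Infinite R]
    [Finite (R ⧸ maximalIdeal R)]
    (h : ∀ (M : Type v) [AddCommGroup M] [Module R M] [Finite M]
      (e : Ext (ModuleCat.of R M) (ModuleCat.of R R) 2), e = 0)
    (M : Type v) [AddCommGroup M] [Module R M] [Finite M] :
    ∃ l : ℕ, Nat.card M = Nat.card (R ⧸ maximalIdeal R) ^ l ∧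
      Nat.card (ExtOne R M) = Nat.card (ExtOne R (R ⧸ maximalIdeal R)) ^ l := by
  refine finite_module_induction (motive := fun M =>
    ∃ l : ℕ, Nat.card M = Nat.card (R ⧸ maximalIdeal R) ^ l ∧
      Nat.card (Ext M (ModuleCat.of R R) 1) =
        Nat.card (ExtOne R (R ⧸ maximalIdeal R)) ^ l) ?_ ?_ M
  · intro M _ _ _
    refine ⟨0, by simp, ?_⟩
    have : Subsingleton (ExtOne R M) :=
      subsingleton_of_forall_eq 0 fun e => ext_eq_zero_of_subsingleton e
    rw [pow_zero]
    exact Nat.card_eq_one_iff_unique.2 ⟨this, ⟨0⟩⟩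
  · rintro M _ _ _ f hf ⟨l, h₁, h₂⟩
    refine ⟨l + 1, ?_, ?_⟩
    · rw [card_quotient_range f hf, h₁, pow_succ]
    · rw [card_extOne_eq_mul h M f hf, h₂, pow_succ]

/-- The connecting map from Hom(R, R) = R is onto because Ext¹(R, R) = 0, and it is constant on
classes modulo x. -/
theorem exists_surjective_extOne_quotient_span [IsDomain R] {x : R} (hx : x ≠ 0) :
    ∃ ρ : R ⧸ Ideal.span {x} → ExtOne R (R ⧸ Ideal.span {x}), Function.Surjective ρ := by
  have hS := shortExact_shortComplexOfExact (exact_mul_mkQ x) (mul_right_injective₀ hx)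
    (Submodule.mkQ_surjective _)
  let ρ : R → ExtOne R (R ⧸ Ideal.span {x}) := fun r =>
    hS.extClass.comp (Ext.mk₀ (ModuleCat.ofHom (LinearMap.mulLeft R r))) (add_zero 1)
  have hρ : Function.Surjective ρ := by
    intro e
    obtain ⟨y, rfl⟩ := Ext.contravariant_sequence_exact₃ hS _ e (Ext.eq_zero_of_projective _)
      (n₀ := 0) (by omega)
    refine ⟨(Ext.homEquiv₀ y).hom (1 : R), ?_⟩
    rw [← Ext.mk₀_homEquiv₀_apply y]
    change hS.extClass.comp (Ext.mk₀ _) _ = _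
    congr 2
    ext1
    refine LinearMap.ext_ring ?_
    simp
  have hker : ∀ a b : R, (Submodule.Quotient.mk a : R ⧸ Ideal.span {x}) = Submodule.Quotient.mk b →
      ρ a = ρ b := by
    intro a b hab
    rw [Submodule.Quotient.eq, Ideal.mem_span_singleton'] at hab
    obtain ⟨c, hc⟩ := hab
    have e : ModuleCat.ofHom (LinearMap.mulLeft R a) = ModuleCat.ofHom (LinearMap.mulLeft R b) +
        (shortComplexOfExact (exact_mul_mkQ x)).f ≫ ModuleCat.ofHom (LinearMap.mulLeft R c) := by
      ext1
      refine LinearMap.ext_ring ?_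
      simp
      linear_combination -hc
    change hS.extClass.comp (Ext.mk₀ _) _ = hS.extClass.comp (Ext.mk₀ _) _
    rw [e, Ext.mk₀_add, Ext.comp_add, ← Ext.mk₀_comp_mk₀]
    exact (congrArg _ (hS.extClass_comp_assoc _)).trans (add_zero _)
  refine ⟨fun z => Quotient.liftOn' z ρ fun a b hab => hker a b (Quotient.sound' hab), fun e => ?_⟩
  obtain ⟨r, rfl⟩ := hρ e
  exact ⟨Submodule.Quotient.mk r, rfl⟩

/-- For a suitable l ≠ 0, |Ext¹(k,R)|^l = |Ext¹(R/x,R)| ≤ |R/x| = |k|^l. -/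
theorem card_extOne_residueField_le [IsLocalRing R] [IsDomain R] [Infinite R] {x : R} (hx : x ≠ 0)
    (hxm : x ∈ maximalIdeal R) [Finite (R ⧸ Ideal.span {x})] {n : ℕ}
    [HasInjectiveDimensionLE (ModuleCat.of R R) n] :
    Finite (ExtOne R (R ⧸ maximalIdeal R)) ∧
      Nat.card (ExtOne R (R ⧸ maximalIdeal R)) ≤ Nat.card (R ⧸ maximalIdeal R) := by
  have hle : Ideal.span {x} ≤ maximalIdeal R := (Ideal.span_singleton_le_iff_mem _).2 hxm
  have : Finite (R ⧸ maximalIdeal R) :=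
    Finite.of_surjective _ (Ideal.Quotient.factor_surjective hle)
  have : Nontrivial (R ⧸ Ideal.span {x}) :=
    Ideal.Quotient.nontrivial_iff.2 (ne_top_of_le_ne_top Ideal.IsPrime.ne_top' hle)
  obtain ⟨l, h₁, h₂⟩ := exists_card_eq_pow
    (fun M _ _ _ e => ext_two_finite_eq_zero hx hxm (ModuleCat.of R R) (n := n) M e)
    (R ⧸ Ideal.span {x})
  obtain ⟨ρ, hρ⟩ := exists_surjective_extOne_quotient_span hx
  have : Finite (ExtOne R (R ⧸ Ideal.span {x})) := Finite.of_surjective ρ hρ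
  have : Nonempty (ExtOne R (R ⧸ Ideal.span {x})) := ⟨0⟩
  have hl : l ≠ 0 := by
    rintro rfl
    have : 1 < Nat.card (R ⧸ Ideal.span {x}) := Finite.one_lt_card
    rw [h₁, pow_zero] at this
    exact lt_irrefl _ this
  have hle' := Nat.card_le_card_of_surjective ρ hρ
  rw [h₁, h₂] at hle'
  refine ⟨?_, (Nat.pow_le_pow_iff_left hl).1 hle'⟩
  -- `Nat.card` vanishes on infinite types, so finiteness follows from the nonzero l-th power.
  refine Nat.finite_of_card_ne_zero fun h0 => ?_
  rw [h0, zero_pow hl] at h₂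
  exact Nat.card_pos.ne' h₂

theorem exact_subtype_mkQ (I : Ideal R) : Function.Exact I.subtype I.mkQ := by
  intro y
  rw [Submodule.mkQ_apply, Submodule.Quotient.mk_eq_zero]
  exact ⟨fun h => ⟨⟨y, h⟩, rfl⟩, fun ⟨z, hz⟩ => hz ▸ z.2⟩

/-- The connecting homomorphism `Hom(I, R) → Ext¹(R / I, R)`, whose kernel consists of
multiplications by elements of `R`. -/
theorem exists_connectingHom (I : Ideal R) :
    ∃ Φ : (I →ₗ[R] R) →+ ExtOne R (R ⧸ I), ∀ φ, Φ φ = 0 → ∃ r : R, ∀ t : I, φ t = t * r := by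
  have hS := shortExact_shortComplexOfExact (exact_subtype_mkQ I) I.injective_subtype
    I.mkQ_surjective
  refine ⟨AddMonoidHom.mk' (fun φ => hS.extClass.comp (Ext.mk₀ (ModuleCat.ofHom φ)) (add_zero 1))
    fun φ ψ => ?_, fun φ hφ => ?_⟩
  · rw [← Ext.comp_add, ← Ext.mk₀_add]
    rfl
  · obtain ⟨y, hy⟩ := Ext.contravariant_sequence_exact₁ hS _
      (Ext.mk₀ (ModuleCat.ofHom φ)) (n₁ := 1) (by omega) hφ
    rw [← Ext.mk₀_homEquiv₀_apply y, Ext.mk₀_comp_mk₀] at hy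
    have hy' := (Ext.mk₀_bijective _ _).1 hy
    refine ⟨(Ext.homEquiv₀ y).hom (1 : R), fun t => ?_⟩
    have h₁ : φ t = (Ext.homEquiv₀ y).hom (t : R) :=
      (congrArg (fun g : ModuleCat.of R I ⟶ ModuleCat.of R R => g.hom t) hy').symm
    rw [h₁]
    conv_lhs => rw [← mul_one (t : R)]
    exact map_smul (Ext.homEquiv₀ y).hom (t : R) (1 : R)

end InjectiveDimension

/-! ### From finite injective dimension to an invertible trace dual. -/

section Gorenstein

open IsLocalRing

universe v

variable {K : Type v} [Field K] [NumberField K] {T : Subring K}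

theorem index_coeSubmodule_one (p : Ideal T) :
    index (IsLocalization.coeSubmodule K p) 1 = Nat.card (T ⧸ p) := by
  have h₁ : (1 : Submodule T K).toAddSubgroup = T.subtype.toAddMonoidHom.range := by
    ext x
    exact mem_one_iff.trans ⟨fun hx => ⟨⟨x, hx⟩, rfl⟩, fun ⟨y, hy⟩ => hy ▸ y.2⟩
  have h₂ : (IsLocalization.coeSubmodule K p).toAddSubgroup.comap T.subtype.toAddMonoidHom =
      p.toAddSubgroup := by
    ext x
    exact mem_coeSubmodule_iff
  rw [index, h₁, ← AddSubgroup.index_comap, h₂]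
  rfl

theorem finite_quotient_natCast (hT : IsOrder T) {n : ℕ} (hn : n ≠ 0) :
    Finite (T ⧸ Ideal.span {(n : T)}) := by
  have hne : Ideal.span {(n : T)} ≠ ⊥ := by
    rw [Ne, Ideal.span_singleton_eq_bot]
    exact fun h => hn (by exact_mod_cast congrArg (fun t : T => (t : K)) h)
  refine Nat.finite_of_card_ne_zero ?_
  rw [← index_coeSubmodule_one]
  exact index_ne_zero hT fg_one (coeSubmodule_ne_bot hne)

theorem exists_natCast_mem (hT : IsOrder T) {p : Ideal T} (hp : p ≠ ⊥) :
    ∃ n : ℕ, n ≠ 0 ∧ (n : T) ∈ p := by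
  obtain ⟨n, hn, h⟩ := exists_nat_mul_mem_submodule hT (coeSubmodule_ne_bot hp) 1
  exact ⟨n, hn, mem_coeSubmodule_iff.1 (by simpa using h)⟩

/-- Every class is a fraction b/s whose value depends only on b and s modulo a. -/
theorem finite_quotient_localization {A R : Type*} [CommRing A] [CommRing R] [Algebra A R]
    (M : Submonoid A) [IsLocalization M R] (a : A) [Finite (A ⧸ Ideal.span {a})] :
    Finite (R ⧸ Ideal.span {algebraMap A R a}) := by
  let g : A ⧸ Ideal.span {a} →+* R ⧸ Ideal.span {algebraMap A R a} :=
    Ideal.quotientMap _ (algebraMap A R) (by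
      rw [Ideal.span_singleton_le_iff_mem]
      exact Ideal.mem_span_singleton_self _)
  refine Finite.of_surjective (fun z : (A ⧸ Ideal.span {a}) × (A ⧸ Ideal.span {a}) =>
    g z.1 * Ring.inverse (g z.2)) fun y => ?_
  obtain ⟨y, rfl⟩ := Ideal.Quotient.mk_surjective y
  obtain ⟨⟨b, s⟩, h⟩ := IsLocalization.surj M y
  refine ⟨⟨Ideal.Quotient.mk _ b, Ideal.Quotient.mk _ s⟩, ?_⟩
  simp only [g, Ideal.quotientMap_mk]
  rw [← h, map_mul, mul_assoc, Ring.mul_inverse_cancel _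
    ((IsLocalization.map_units R s).map (Ideal.Quotient.mk _)), mul_one]

/-- Makes multiplication by an element of (T:p) a homomorphism from the maximal ideal of R to R. -/
theorem exists_algebraMap_eq_mul {p : Ideal T} [p.IsPrime] {R : Type v} [CommRing R] [IsLocalRing R]
    [Algebra T R] [IsLocalization.AtPrime R p] [Algebra R K] [IsScalarTower T R K] {y : K}
    (hy : y ∈ 1 / IsLocalization.coeSubmodule K p) {t : R} (ht : t ∈ maximalIdeal R) :
    ∃ r : R, algebraMap R K r = algebraMap R K t * y := by
  obtain ⟨⟨a, s⟩, h⟩ := IsLocalization.surj p.primeCompl t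
  have ha : a ∈ p := by
    rw [← IsLocalization.AtPrime.under_maximalIdeal R p, Ideal.mem_comap, ← h]
    exact Ideal.mul_mem_right _ _ ht
  obtain ⟨c, hc⟩ := Submodule.mem_one.1
    (Submodule.mem_div_iff_forall_mul_mem.1 hy _ (mem_coeSubmodule_iff.2 ha))
  have hs : algebraMap R K (algebraMap T R s) ≠ 0 :=
    ((IsLocalization.map_units R s).map (algebraMap R K)).ne_zero
  refine ⟨IsLocalization.mk' R c s, mul_right_cancel₀ hs ?_⟩
  rw [← map_mul, IsLocalization.mk'_spec, ← IsScalarTower.algebraMap_apply, hc, mul_right_comm,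
    ← map_mul, h, ← IsScalarTower.algebraMap_apply, mul_comm]
  rfl

/-- The ideal of t with ty ∈ T contains p, and also a denominator of y outside p; so it is T. -/
theorem mem_one_of_algebraMap_eq {p : Ideal T} (hp : p.IsMaximal) {R : Type v} [CommRing R]
    [Algebra T R] [IsLocalization.AtPrime R p] [Algebra R K] [IsScalarTower T R K] {y : K}
    (hy : y ∈ 1 / IsLocalization.coeSubmodule K p) {r : R} (hr : algebraMap R K r = y) :
    y ∈ (1 : Submodule T K) := by
  obtain ⟨⟨a, s⟩, h⟩ := IsLocalization.surj p.primeCompl r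
  let J : Ideal T := (1 : Submodule T K).comap (LinearMap.toSpanSingleton T K y)
  have hpJ : p < J := by
    refine lt_of_le_of_ne (fun t ht => ?_) fun hpJ => ?_
    · have := Submodule.mem_div_iff_forall_mul_mem.1 hy _ (mem_coeSubmodule_iff.2 ht)
      rw [mul_comm] at this
      exact this
    · have hs : (s : T) ∉ J := fun hs => s.2 (by rwa [← hpJ] at hs)
      refine hs ?_
      change (s : T) • y ∈ (1 : Submodule T K)
      refine Submodule.mem_one.2 ⟨a, ?_⟩
      rw [IsScalarTower.algebraMap_apply T R K, ← h, map_mul, hr, Algebra.smul_def,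
        ← IsScalarTower.algebraMap_apply, mul_comm]
  have := (Ideal.eq_top_iff_one _).1 (hp.1.2 _ hpJ)
  change (1 : T) • y ∈ (1 : Submodule T K) at this
  rwa [one_smul] at this

/-- If the localization of `T` at a maximal ideal `p` has finite injective dimension, then
`(T : p) / T` is at most one-dimensional over the residue field. -/
theorem index_one_one_div_le (hT : IsOrder T) {p : Ideal T} (hp : p.IsMaximal) (hp0 : p ≠ ⊥)
    {R : Type v} [CommRing R] [Algebra T R] [IsLocalization.AtPrime R p] [Algebra R K]
    [IsScalarTower T R K] {n : ℕ}
    [CategoryTheory.HasInjectiveDimensionLE (ModuleCat.of R R) n] :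
    index 1 (1 / IsLocalization.coeSubmodule K p) ≤
      index (IsLocalization.coeSubmodule K p) 1 := by
  have := hT.isFractionRing
  have : IsLocalRing R := IsLocalization.AtPrime.isLocalRing R p
  have : IsDomain R := IsLocalization.isDomain_of_le_nonZeroDivisors R
    p.primeCompl_le_nonZeroDivisors
  have : IsFractionRing R K :=
    IsFractionRing.isFractionRing_of_isDomain_of_isLocalization p.primeCompl R K
  have hι : Function.Injective (algebraMap R K) := IsFractionRing.injective R K
  obtain ⟨k, hk, hkp⟩ := exists_natCast_mem hT hp0
  have := finite_quotient_natCast hT hk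
  have := finite_quotient_localization (R := R) p.primeCompl (k : T)
  have hx : algebraMap T R (k : T) ≠ 0 := by
    rw [map_natCast]
    intro h
    have := congrArg (algebraMap R K) h
    rw [map_natCast, map_zero] at this
    exact hk (by exact_mod_cast this)
  have hxm : algebraMap T R (k : T) ∈ maximalIdeal R := by
    rwa [← IsLocalization.AtPrime.under_maximalIdeal R p] at hkp
  have : Infinite R := by
    refine Infinite.of_injective (fun m : ℕ => (m : R)) fun a b hab => ?_
    have := congrArg (algebraMap R K) hab
    simpa using this
  obtain ⟨hfin, hcard⟩ := card_extOne_residueField_le hx hxm (n := n)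
  obtain ⟨Φ, hΦ⟩ := exists_connectingHom (maximalIdeal R)
  choose g hg using fun (y : (1 / IsLocalization.coeSubmodule K p).toAddSubgroup)
    (t : maximalIdeal R) => exists_algebraMap_eq_mul (R := R) y.2 t.2
  let φ (y : (1 / IsLocalization.coeSubmodule K p).toAddSubgroup) : maximalIdeal R →ₗ[R] R :=
    { toFun := g y
      map_add' := fun s t => hι (by simp only [hg, map_add, Submodule.coe_add, add_mul])
      map_smul' := fun r t => hι (by
        simp only [hg, smul_eq_mul, map_mul, Submodule.coe_smul, RingHom.id_apply, mul_assoc]) }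
  let φ' : (1 / IsLocalization.coeSubmodule K p).toAddSubgroup →+ (maximalIdeal R →ₗ[R] R) :=
    AddMonoidHom.mk' φ fun y z => LinearMap.ext fun t => hι (by
      change algebraMap R K (g _ _) = algebraMap R K (g _ _ + g _ _)
      simp only [hg, map_add, AddSubgroup.coe_add, mul_add])
  -- If the Ext class of multiplication by y vanishes, that map is multiplication by some r ∈ R.
  -- Evaluating at k ≠ 0 gives y = r, so y ∈ T. Thus [(T:p):T] is at most the size of Ext¹.
  have hker : (Φ.comp φ').ker ≤ (1 : Submodule T K).toAddSubgroup.addSubgroupOf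
      (1 / IsLocalization.coeSubmodule K p).toAddSubgroup := by
    intro y hy
    obtain ⟨r, hr⟩ := hΦ _ hy
    refine mem_one_of_algebraMap_eq (R := R) hp y.2 (r := r) ?_
    have h : g y ⟨_, hxm⟩ = algebraMap T R (k : T) * r := hr ⟨_, hxm⟩
    have h' := hg y ⟨_, hxm⟩
    rw [h, map_mul] at h'
    exact mul_left_cancel₀ ((map_ne_zero_iff _ hι).2 hx) h'
  have hrange : Finite (Φ.comp φ').range := inferInstance
  calc index 1 (1 / IsLocalization.coeSubmodule K p)
      ≤ (Φ.comp φ').ker.index := by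
        refine Nat.le_of_dvd ?_ (AddSubgroup.index_dvd_of_le hker)
        rw [AddSubgroup.index_ker]
        exact Nat.card_pos
    _ = Nat.card (Φ.comp φ').range := AddSubgroup.index_ker _
    _ ≤ Nat.card (ExtOne R (R ⧸ maximalIdeal R)) :=
        Nat.card_le_card_of_injective _ (AddSubgroup.subtype_injective _)
    _ ≤ Nat.card (R ⧸ maximalIdeal R) := hcard
    _ = Nat.card (T ⧸ p) :=
        (Nat.card_congr (IsLocalization.AtPrime.equivQuotMaximalIdeal p R).toEquiv).symm
    _ = index (IsLocalization.coeSubmodule K p) 1 := (index_coeSubmodule_one p).symm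

theorem isUnit_dual_one_of_isGorensteinRing (hT : IsOrder T) (h : IsGorensteinRing T) :
    IsUnit (dual (1 : Submodule T K)) := by
  have := hT.isFractionRing
  refine isUnit_of_forall_exists fun p hp => ?_
  have hp0 : p ≠ ⊥ := Ring.ne_bot_of_isMaximal_of_not_isField hp hT.not_isField
  obtain ⟨n, hn⟩ := h.2 p
  let : Algebra (Localization.AtPrime p) K :=
    IsLocalization.localizationAlgebraOfSubmonoidLe (Localization.AtPrime p) K p.primeCompl
      (nonZeroDivisors T) p.primeCompl_le_nonZeroDivisors
  have : IsScalarTower T (Localization.AtPrime p) K :=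
    IsLocalization.localization_isScalarTower_of_submonoid_le _ K p.primeCompl
      (nonZeroDivisors T) p.primeCompl_le_nonZeroDivisors
  exact exists_notMem_of_index_le hT hp hp0
    (index_one_one_div_le (R := Localization.AtPrime p) hT hp hp0 (n := n))

end Gorenstein

end

/-! ### From an invertible trace dual to injective dimension at most one. -/

section

open IsLocalRing

universe v

variable {K : Type v} [Field K] [NumberField K] {T : Subring K}

/-- The pairing `K × T → ℚ / ℤ` induced by the trace form. -/
noncomputable def toCharacterModule (T : Subring K) : K →ₗ[T] CharacterModule T where
  toFun x := (QuotientAddGroup.mk' (AddSubgroup.zmultiples (1 : ℚ))).comp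
    ((Algebra.traceForm ℚ K x).toAddMonoidHom.comp T.subtype.toAddMonoidHom)
  map_add' x y := by
    ext t
    change ((Algebra.traceForm ℚ K (x + y) t : ℚ) : AddCircle (1 : ℚ)) =
      ((Algebra.traceForm ℚ K x t + Algebra.traceForm ℚ K y t : ℚ) : AddCircle (1 : ℚ))
    rw [map_add, LinearMap.add_apply]
  map_smul' s x := by
    ext t
    change ((Algebra.traceForm ℚ K (s * x) t : ℚ) : AddCircle (1 : ℚ)) =
      ((Algebra.traceForm ℚ K x (s * t) : ℚ) : AddCircle (1 : ℚ))
    rw [Algebra.traceForm_apply, Algebra.traceForm_apply, mul_left_comm, mul_assoc]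

theorem toCharacterModule_apply (x : K) (t : T) :
    toCharacterModule T x t = ((Algebra.trace ℚ K (x * t) : ℚ) : AddCircle (1 : ℚ)) :=
  rfl

theorem ker_toCharacterModule : (toCharacterModule T).ker = dual 1 := by
  ext x
  rw [LinearMap.mem_ker, Submodule.mem_traceDual]
  constructor
  · intro h a ha
    have : toCharacterModule T x ⟨a, mem_one_iff.1 ha⟩ = 0 := by rw [h]; rfl
    rw [toCharacterModule_apply, AddCircle.coe_eq_zero_iff] at this
    obtain ⟨n, hn⟩ := this
    exact ⟨n, by simpa using hn⟩
  · intro h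
    ext t
    rw [toCharacterModule_apply]
    refine (AddCircle.coe_eq_zero_iff _).2 ?_
    obtain ⟨n, hn⟩ := h t (mem_one_iff.2 t.2)
    exact ⟨n, by simpa using hn⟩

/-- T is free over ℤ, so a character lifts to a map T → ℚ, which extends to K and is represented by
an element of K through the nondegenerate trace form. -/
theorem toCharacterModule_surjective (hT : IsOrder T) :
    Function.Surjective (toCharacterModule T) := by
  intro c
  have := hT.finite
  obtain ⟨g, hg⟩ := Module.projective_lifting_property
    (QuotientAddGroup.mk' (AddSubgroup.zmultiples (1 : ℚ))).toIntLinearMap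
    (AddMonoidHom.toIntLinearMap (c : T →+ AddCircle (1 : ℚ))) (QuotientAddGroup.mk'_surjective _)
  obtain ⟨n, b, hb⟩ := exists_basis_span_eq hT (fg_one (T := T)) one_ne_bot
  have hbT : ∀ a ∈ Submodule.span ℤ (Set.range b), a ∈ T := fun a ha =>
    mem_one_iff.1 ((Submodule.restrictScalars_mem ℤ _ _).1 (hb ▸ ha))
  let l : Module.Dual ℚ K :=
    b.constr ℚ fun i => g ⟨b i, hbT _ (Submodule.subset_span ⟨i, rfl⟩)⟩
  let x := ((Algebra.traceForm ℚ K).toDual (traceForm_nondegenerate ℚ K)).symm l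
  refine ⟨x, ?_⟩
  have key : ∀ (a : K) (ha : a ∈ Submodule.span ℤ (Set.range b)),
      Algebra.traceForm ℚ K x a = g ⟨a, hbT a ha⟩ := by
    intro a ha
    induction ha using Submodule.span_induction with
    | mem a ha =>
      obtain ⟨i, rfl⟩ := ha
      rw [LinearMap.BilinForm.apply_toDual_symm_apply]
      exact b.constr_basis ℚ _ i
    | zero => rw [map_zero]; exact (map_zero g).symm
    | add a a' ha ha' h h' =>
      rw [map_add, h, h', ← map_add]
      rfl
    | smul m a ha h =>
      rw [map_zsmul, h, ← map_smul]
      rfl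
  ext t
  have ht : (t : K) ∈ Submodule.span ℤ (Set.range b) := by
    rw [← hb]
    exact (Submodule.restrictScalars_mem ℤ _ _).2 (mem_one_iff.2 t.2)
  have := key t ht
  rw [toCharacterModule_apply, ← Algebra.traceForm_apply, this]
  exact LinearMap.congr_fun hg t

/-- The quotient of `K` by the dual of an order `T` is an injective `T`-module. -/
theorem injective_quotient_dual_one (hT : IsOrder T) :
    Module.Injective T (K ⧸ dual (1 : Submodule T K)) := by
  -- The quotient is the character module of T, which is injective because T is flat over itself.
  rw [← Module.Baer.iff_injective, ← ker_toCharacterModule, Module.Baer.congr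
    ((toCharacterModule T).quotKerEquivOfSurjective (toCharacterModule_surjective hT)),
    ← Module.Flat.iff_characterModule_baer]
  infer_instance

theorem injective_fractionRing (R F : Type*) [CommRing R] [IsDomain R] [Field F] [Algebra R F]
    [IsFractionRing R F] : Module.Baer R F := by
  intro I g
  by_cases hI : I = ⊥
  · refine ⟨0, fun x hx => ?_⟩
    have : (⟨x, hx⟩ : I) = 0 := Subtype.ext ((Submodule.mem_bot R).1 (hI ▸ hx))
    rw [this, map_zero, LinearMap.zero_apply]
  · obtain ⟨t, ht, ht0⟩ := Submodule.exists_mem_ne_zero_of_ne_bot hI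
    have ht' : algebraMap R F t ≠ 0 := (map_ne_zero_iff _ (IsFractionRing.injective R F)).2 ht0
    refine ⟨LinearMap.toSpanSingleton R F (g ⟨t, ht⟩ / algebraMap R F t), fun s hs => ?_⟩
    have : s • g ⟨t, ht⟩ = t • g ⟨s, hs⟩ := by
      rw [← map_smul, ← map_smul]
      exact congrArg g (Subtype.ext (mul_comm s t))
    rw [LinearMap.toSpanSingleton_apply, Algebra.smul_def, ← mul_div_assoc, ← Algebra.smul_def, this,
      Algebra.smul_def, mul_div_cancel_left₀ _ ht']

/-- Otherwise W(T:W) = T would be contained in p. The element a is a local generator of W. -/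
theorem exists_mul_eq_of_isUnit {W : Submodule T K} (hW : IsUnit W) (p : Ideal T) [p.IsPrime] :
    ∃ a ∈ W, ∃ b ∈ 1 / W, ∃ s : T, s ∉ p ∧ a * b = s := by
  by_contra! h
  have hle : W * (1 / W) ≤ IsLocalization.coeSubmodule K p := by
    refine Submodule.mul_le.2 fun a ha b hb => ?_
    have : a * b ∈ (1 : Submodule T K) := by
      rw [mul_comm]
      exact Submodule.mem_div_iff_forall_mul_mem.1 hb a ha
    obtain ⟨s, hs⟩ := Submodule.mem_one.1 this
    rw [← hs]
    refine mem_coeSubmodule_iff.2 ?_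
    by_contra hsp
    exact h a ha b hb s hsp hs.symm
  rw [isUnit_iff_mul_one_div.1 hW] at hle
  have h₁ : ((1 : T) : K) ∈ IsLocalization.coeSubmodule K p := hle one_mem_one
  exact Ideal.IsPrime.one_notMem inferInstance (mem_coeSubmodule_iff.1 h₁)

/-- If `W` is an invertible `T`-module in `K` such that `K / W` is injective, then `K / R` is
injective for every localization `R` of `T` at a prime. -/
theorem injective_quotient_range (hT : IsOrder T) {W : Submodule T K} (hW : IsUnit W)
    [Module.Injective T (K ⧸ W)] (p : Ideal T) [p.IsPrime]
    {R : Type v} [CommRing R] [Algebra T R] [IsLocalization.AtPrime R p] [Algebra R K]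
    [IsScalarTower T R K] :
    Module.Injective R (K ⧸ LinearMap.range (Algebra.linearMap R K)) := by
  have := hT.isNoetherianRing
  obtain ⟨a, ha, b, hb, s, hs, hab⟩ := exists_mul_eq_of_isUnit hW p
  have hs0 : (s : K) ≠ 0 := fun h => hs (by
    rw [show s = 0 from Subtype.ext h]
    exact p.zero_mem)
  have ha0 : a ≠ 0 := fun h => hs0 (by rw [← hab, h, zero_mul])
  -- For w ∈ W, a⁻¹w = bw/s with bw ∈ T and s ∉ p, so division by a carries W into R.
  let μ : K →ₗ[T] K := LinearMap.mulLeft T a⁻¹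
  have hdiv (c : T) (q : T) (hq : q ∉ p) :
      (c / q : K) ∈ LinearMap.range (Algebra.linearMap R K) := by
    refine ⟨IsLocalization.mk' R c (⟨q, hq⟩ : p.primeCompl), ?_⟩
    have hq0 : (q : K) ≠ 0 := fun h => hq (by
      rw [show q = 0 from Subtype.ext h]
      exact p.zero_mem)
    rw [eq_div_iff hq0, Algebra.linearMap_apply]
    have := congrArg (algebraMap R K) (IsLocalization.mk'_spec R c (⟨q, hq⟩ : p.primeCompl))
    rwa [map_mul, ← IsScalarTower.algebraMap_apply, ← IsScalarTower.algebraMap_apply] at this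
  have hμ : W ≤ ((LinearMap.range (Algebra.linearMap R K)).restrictScalars T).comap μ := by
    intro w hw
    obtain ⟨c, hc⟩ := Submodule.mem_one.1 (Submodule.mem_div_iff_forall_mul_mem.1 hb w hw)
    have h := hdiv c s hs
    have : (c / s : K) = a⁻¹ * w := by
      rw [div_eq_iff hs0, ← hab]
      change algebraMap T K c = _
      rw [hc]
      field_simp
    rw [this] at h
    exact h
  let f : (K ⧸ W) →ₗ[T] (K ⧸ LinearMap.range (Algebra.linearMap R K)) :=
    W.mapQ ((LinearMap.range (Algebra.linearMap R K)).restrictScalars T) μ hμ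
  -- Division by a exhibits K/R as K/W localized at p; over a Noetherian ring localization preserves
  -- injectivity.
  have : IsLocalizedModule p.primeCompl f := by
    refine ⟨fun q => ?_, fun y => ?_, fun {x y} h => ?_⟩
    · refine (Module.End.isUnit_iff _).2 ?_
      convert MulAction.bijective (IsLocalization.map_units R q).unit using 1
      funext y
      exact (algebraMap_smul R (q : T) y).symm
    · obtain ⟨y, rfl⟩ := Submodule.Quotient.mk_surjective _ y
      refine ⟨⟨Submodule.Quotient.mk (a * y), 1⟩, ?_⟩
      rw [one_smul]
      change _ = Submodule.Quotient.mk (a⁻¹ * (a * y))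
      rw [inv_mul_cancel_left₀ ha0]
    · obtain ⟨x, rfl⟩ := Submodule.Quotient.mk_surjective _ x
      obtain ⟨y, rfl⟩ := Submodule.Quotient.mk_surjective _ y
      have h' := (Submodule.Quotient.eq _).1 h
      obtain ⟨r, hr⟩ := h'
      obtain ⟨⟨c, q⟩, hq⟩ := IsLocalization.surj p.primeCompl r
      refine ⟨q, ?_⟩
      rw [← Submodule.Quotient.mk_smul, ← Submodule.Quotient.mk_smul, Submodule.Quotient.eq,
        ← smul_sub]
      have hr' : algebraMap R K r = a⁻¹ * (x - y) := by
        rw [mul_sub]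
        exact hr
      have : q • (x - y) = c • a := by
        have := congrArg (algebraMap R K) hq
        rw [map_mul, hr', ← IsScalarTower.algebraMap_apply, ← IsScalarTower.algebraMap_apply] at this
        change (q : T) • (x - y) = _
        rw [Algebra.smul_def, Algebra.smul_def, ← this]
        field_simp
      rw [this]
      exact W.smul_mem c ha
  exact Module.injective_of_isLocalizedModule p.primeCompl f

theorem hasInjectiveDimensionLE_one (hT : IsOrder T) (hW : IsUnit (dual (1 : Submodule T K)))
    (p : Ideal T) [p.IsPrime] {R : Type v} [CommRing R] [Algebra T R]
    [IsLocalization.AtPrime R p] [Algebra R K] [IsScalarTower T R K] :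
    CategoryTheory.HasInjectiveDimensionLE (ModuleCat.of R R) 1 := by
  have := hT.isFractionRing
  have : IsDomain R :=
    IsLocalization.isDomain_of_le_nonZeroDivisors R p.primeCompl_le_nonZeroDivisors
  have : IsFractionRing R K :=
    IsFractionRing.isFractionRing_of_isDomain_of_isLocalization p.primeCompl R K
  have := injective_quotient_dual_one hT
  have h₃ := injective_quotient_range hT hW p (R := R)
  have h₂ : Module.Injective R K := (injective_fractionRing R K).injective
  rw [Module.injective_iff_injective_object] at h₂ h₃
  have hS := shortExact_shortComplexOfExact (Algebra.linearMap R K).exact_map_mkQ_range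
    (IsFractionRing.injective R K) (Submodule.mkQ_surjective _)
  exact (hS.hasInjectiveDimensionLT_X₃_iff 0 h₂).1
    (inferInstanceAs (CategoryTheory.HasInjectiveDimensionLT
      (ModuleCat.of R (K ⧸ LinearMap.range (Algebra.linearMap R K))) 1))

theorem isGorensteinRing_iff (hT : IsOrder T) :
    IsGorensteinRing T ↔ IsUnit (dual (1 : Submodule T K)) := by
  refine ⟨isUnit_dual_one_of_isGorensteinRing hT, fun h => ⟨hT.isNoetherianRing, fun p _ => ⟨1, ?_⟩⟩⟩
  have := hT.isFractionRing
  let : Algebra (Localization.AtPrime p) K :=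
    IsLocalization.localizationAlgebraOfSubmonoidLe (Localization.AtPrime p) K p.primeCompl
      (nonZeroDivisors T) p.primeCompl_le_nonZeroDivisors
  have : IsScalarTower T (Localization.AtPrime p) K :=
    IsLocalization.localization_isScalarTower_of_submonoid_le _ K p.primeCompl
      (nonZeroDivisors T) p.primeCompl_le_nonZeroDivisors
  exact hasInjectiveDimensionLE_one hT h p

end

/-! ### Passage to fractional ideals, and the bounds. -/

variable {K : Type*} [Field K] [NumberField K] {T : Subring K}

theorem coe_fractionalIdeal_fg (hT : IsOrder T) (I : FractionalIdeal (nonZeroDivisors T) K) :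
    (I : Submodule T K).FG := by
  have := hT.isFractionRing
  have := hT.isNoetherianRing
  exact (isNoetherian_submodule.1 I.isNoetherian) _ le_rfl

theorem coe_fractionalIdeal_ne_bot {I : FractionalIdeal (nonZeroDivisors T) K} (hI : I ≠ 0) :
    (I : Submodule T K) ≠ ⊥ :=
  fun h => hI (FractionalIdeal.coeToSubmodule_injective (h.trans FractionalIdeal.coe_zero.symm))

theorem forall_ideal_iff {motive : Submodule T K → Prop} :
    (∀ J : Ideal T, J ≠ ⊥ → motive (J : FractionalIdeal (nonZeroDivisors T) K)) ↔
      ∀ J : Submodule T K, J ≤ 1 → J ≠ ⊥ → motive J := by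
  simp only [FractionalIdeal.coe_coeIdeal]
  constructor
  · intro h J hJ hJ0
    have hcoe : IsLocalization.coeSubmodule K (J.comap (Algebra.linearMap T K)) = J := by
      refine Submodule.map_comap_eq_of_le ?_
      rwa [← Submodule.one_eq_range]
    rw [← hcoe]
    refine h _ fun h0 => hJ0 ?_
    rw [← hcoe, h0, IsLocalization.coeSubmodule_bot]
  · exact fun h J hJ => h _ (coeSubmodule_le_one J) (coeSubmodule_ne_bot hJ)

theorem one_le_discrepancy (hT : IsOrder T) {I : Submodule T K} (hI : I.FG) (hI0 : I ≠ ⊥) :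
    1 ≤ discrepancy I := by
  rw [discrepancy_eq hT hI hI0, one_le_div]
  · exact_mod_cast index_maximalOrder_mul_le hT hI hI0
  · exact_mod_cast Nat.pos_of_ne_zero (index_ne_zero hT (fg_maximalOrder.mul hI) hI0)

theorem discrepancy_le_index (hT : IsOrder T) {I : Submodule T K} (hI : I.FG) (hI0 : I ≠ ⊥) :
    discrepancy I ≤ index 1 (maximalOrder T) := by
  rw [discrepancy_eq hT hI hI0]
  refine div_le_self (Nat.cast_nonneg _) ?_
  exact_mod_cast Nat.one_le_iff_ne_zero.2 (index_ne_zero hT (fg_maximalOrder.mul hI) hI0)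

theorem latticeIndex_integers (hT : IsOrder T) :
    latticeIndex (integers K) T.toAddSubgroup = index 1 (maximalOrder T) := by
  rw [← hT.toAddSubgroup_maximalOrder, ← toAddSubgroup_one,
    latticeIndex_of_le (Submodule.toAddSubgroup_mono hT.one_le_maximalOrder)]

theorem conductor_ne_bot (hT : IsOrder T) : conductor T ≠ ⊥ := by
  obtain ⟨n, hn, h⟩ := exists_nat_forall_mul_mem hT (fg_maximalOrder (T := T)) one_ne_bot
  refine (Submodule.ne_bot_iff _).2 ⟨n, fun b => ?_, by exact_mod_cast hn⟩
  have := h b (hT.mem_maximalOrder.2 b.isIntegral_coe)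
  simpa using mem_one_iff.1 this

theorem one_le_card_quotient_conductor (hT : IsOrder T) :
    1 ≤ Nat.card (NumberField.RingOfIntegers K ⧸ conductor T) := by
  have := Ideal.finiteQuotientOfFreeOfNeBot _ (conductor_ne_bot hT)
  exact Nat.card_pos

end OrderDiscrepancy

theorem theorem4p2 {K : Type*} [Field K] [NumberField K] (T : Subring K)
    (hT : OrderDiscrepancy.IsOrder T) :
    List.TFAE [
      OrderDiscrepancy.discrepancy (OrderDiscrepancy.different T) = 1,
      ∀ J : Ideal T, J ≠ ⊥ →
        (OrderDiscrepancy.discrepancy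
            ((J : FractionalIdeal (nonZeroDivisors T) K) : Submodule T K) = 1 ↔
          (1 : Submodule T K) =
            ((J : FractionalIdeal (nonZeroDivisors T) K) : Submodule T K) /
              ((J : FractionalIdeal (nonZeroDivisors T) K) : Submodule T K)),
      OrderDiscrepancy.IsGorensteinRing T] ∧
    (∀ P I : FractionalIdeal (nonZeroDivisors T) K, P ≠ 0 → I ≠ 0 →
      Module.Projective T (P : Submodule T K) →
        OrderDiscrepancy.discrepancy ((P * I : FractionalIdeal (nonZeroDivisors T) K) :
          Submodule T K) = OrderDiscrepancy.discrepancy (I : Submodule T K)) ∧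
    (∀ I : FractionalIdeal (nonZeroDivisors T) K, I ≠ 0 →
      1 ≤ OrderDiscrepancy.discrepancy (I : Submodule T K) ∧
      OrderDiscrepancy.discrepancy (I : Submodule T K) ≤
        OrderDiscrepancy.latticeIndex (OrderDiscrepancy.integers K) T.toAddSubgroup *
          (Nat.card (NumberField.RingOfIntegers K ⧸ OrderDiscrepancy.conductor T) : ℚ)) := by
  have := hT.isFractionRing
  refine ⟨?_, fun P I hP hI hproj => ?_, fun I hI => ?_⟩
  · have h₁ := OrderDiscrepancy.discrepancy_different_eq_one_iff hT
    have h₂ := (OrderDiscrepancy.forall_ideal_iff (motive := fun J : Submodule T K =>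
      OrderDiscrepancy.discrepancy J = 1 ↔ 1 = J / J)).trans
        (OrderDiscrepancy.forall_discrepancy_eq_one_iff hT)
    tfae_have 1 ↔ 2 := h₁.trans h₂.symm
    tfae_have 1 ↔ 3 := h₁.trans (OrderDiscrepancy.isGorensteinRing_iff hT).symm
    tfae_finish
  · rw [FractionalIdeal.coe_mul]
    exact OrderDiscrepancy.discrepancy_mul_of_isUnit hT
      (OrderDiscrepancy.isUnit_of_projective hT (OrderDiscrepancy.coe_fractionalIdeal_ne_bot hP))
      (OrderDiscrepancy.coe_fractionalIdeal_fg hT P) (OrderDiscrepancy.coe_fractionalIdeal_fg hT I)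
      (OrderDiscrepancy.coe_fractionalIdeal_ne_bot hI)
  · have hfg := OrderDiscrepancy.coe_fractionalIdeal_fg hT I
    have h0 := OrderDiscrepancy.coe_fractionalIdeal_ne_bot hI
    refine ⟨OrderDiscrepancy.one_le_discrepancy hT hfg h0, ?_⟩
    rw [OrderDiscrepancy.latticeIndex_integers hT]
    -- The bound [O:T] already holds; the factor [O:𝔣] ≥ 1 only weakens it.
    refine (OrderDiscrepancy.discrepancy_le_index hT hfg h0).trans
      (le_mul_of_one_le_right (Nat.cast_nonneg _) ?_)
    exact_mod_cast OrderDiscrepancy.one_le_card_quotient_conductor hT
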